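/- Let $g>1$ be real, $n\ge 1$ and $\bm x_n=(x_1,\dots,x_n)\in\mathbb R^n$, and write $\bm x_{n-1}=(x_1,\dots,x_{n-1})$, $\bm\lambda_n=(\lambda_1,\dots,\lambda_n)$, $\bm\nu_{n-1}=(\nu_1,\dots,\nu_{n-1})$. Put $$\mu(\bm\nu_{n-1})=\prod_{1\le a\ne b\le n-1}\Gamma\Big(\frac{\nu_a-\nu_b}{2}\Big)^{-1}\Gamma\Big(\frac{\nu_a-\nu_b+2g}{2}\Big)^{-1},\qquad h_n(\bm\lambda_n,\bm\nu_{n-1})=\sum_{k=1}^n\lambda_k-\sum_{j=1}^{n-1}\nu_j,$$ $$K(\bm\lambda_n,\bm\nu_{n-1})=\prod_{j=1}^{n-1}\prod_{k=1}^{n}\Gamma\Big(\frac{\nu_j-\lambda_k+g}{2}\Big)\Gamma\Big(\frac{\lambda_k-\nu_j+g}{2}\Big).$$ For purely imaginary $\lambda_1,\dots,\lambda_n$ define inductively $\Phi_{\bm\lambda_0}(\bm x_0)=1$ and $$\Phi_{\bm\lambda_n}(\bm x_n)=\int_{(i\mathbb R)^{n-1}}\mu(\bm\nu_{n-1})\,K(\bm\lambda_n,\bm\nu_{n-1})\,e^{h_n(\bm\lambda_n,\bm\nu_{n-1})x_n}\,\Phi_{\bm\nu_{n-1}}(\bm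 x_{n-1})\,d\bm\nu_{n-1}$$ (so that $\Phi_{\lambda_1}(x_1)=e^{\lambda_1x_1}$). This integral converges absolutely, and $\bm\lambda_n\mapsto\Phi_{\bm\lambda_n}(\bm x_n)$ continues holomorphically to the tube $|\operatorname{Re}(\lambda_i-\lambda_j)|<2g$ (all $i,j$); the same holds for $n-1$ in place of $n$. The continuations are denoted by the same symbols. Let $T_{\lambda_i}$ be the shift $\lambda_i\mapsto\lambda_i+2$, and $$\mathcal H_r^{(g)}(\bm\lambda_n)=(-1)^{r(n-1)}\sum_{I\subset\{1,\dots,n\},\,|I|=r}\ \prod_{i\in I,\ j\notin I}\frac{\lambda_i-\lambda_j+2-2g}{\lambda_i-\lambda_j}\ \prod_{i\in I}T_{\lambda_i}$$ (so $\mathcal H_0^{(g)}$ is the identity and $\mathcal H_n^{(g)}(\bm\nu_{n-1})=0$). Then for every $r=1,\dots,n$ and all pairwise distinct $\lambda_1,\dots,\lambda_n$ with $|\operatorname{Re}\lambda_j|<g$ and $|\operatorname{Re}(\lambda_i-\lambda_j)|<2g-2$ for all $i,j$ (in particular for all pairwise distinct imaginary ones), $$\mathcal H_r^{(g)}(\bm\lambda_n)\Phi_{\bm\lambda_n}(\bm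 x_n)=e^{2x_n}\int_{(i\mathbb R)^{n-1}}\mu(\bm\nu_{n-1})K(\bm\lambda_n,\bm\nu_{n-1})e^{h_n(\bm\lambda_n,\bm\nu_{n-1})x_n}\,\mathcal H_{r-1}^{(g)}(\bm\nu_{n-1})\Phi_{\bm\nu_{n-1}}(\bm x_{n-1})\,d\bm\nu_{n-1}$$ $$\qquad+\int_{(i\mathbb R)^{n-1}}\mu(\bm\nu_{n-1})K(\bm\lambda_n,\bm\nu_{n-1})e^{h_n(\bm\lambda_n,\bm\nu_{n-1})x_n}\,\mathcal H_{r}^{(g)}(\bm\nu_{n-1})\Phi_{\bm\nu_{n-1}}(\bm x_{n-1})\,d\bm\nu_{n-1},$$ and both integrals on the right converge absolutely. -/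

import Mathlib

open MeasureTheory

noncomputable section

/-- The Ruijsenaars--Macdonald difference operator `𝓗_r^{(g)}(λ)` in `n` variables, applied to a
function `f` of the spectral variables and evaluated at `lam`. The sum runs over the subsets `s` of
the index set of cardinality `r`, and the variables with index in `s` are shifted by `2`. -/
def dualHamiltonian (g : ℝ) {n : ℕ} (r : ℕ) (f : (Fin n → ℂ) → ℂ) (lam : Fin n → ℂ) : ℂ :=
  (-1) ^ (r * (n - 1)) *
    ∑ s ∈ (Finset.univ : Finset (Fin n)).powersetCard r,
      (∏ i ∈ s, ∏ j ∈ sᶜ, (lam i - lam j + 2 - 2 * (g : ℂ)) / (lam i - lam j)) *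
        f (fun k => if k ∈ s then lam k + 2 else lam k)

/-- The modified Sklyanin weight `μ(ν)`; the product is over ordered pairs `a ≠ b`. -/
def sklyaninWeight (g : ℝ) {n : ℕ} (nu : Fin n → ℂ) : ℂ :=
  ∏ a, ∏ b ∈ Finset.univ.erase a,
    (Complex.Gamma ((nu a - nu b) / 2))⁻¹ * (Complex.Gamma ((nu a - nu b + 2 * (g : ℂ)) / 2))⁻¹

/-- The kernel `K(λ, ν)`, a product of Gamma functions. -/
def gammaKernel (g : ℝ) {n : ℕ} (lam : Fin (n + 1) → ℂ) (nu : Fin n → ℂ) : ℂ :=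
  ∏ j, ∏ k, Complex.Gamma ((nu j - lam k + g) / 2) * Complex.Gamma ((lam k - nu j + g) / 2)

/-- The integrand `μ(ν) K(λ, ν) exp (h(λ, ν) y) f(ν)` at the point `ν = i t` of the imaginary
space, where `h(λ, ν) = ∑ λ_k - ∑ ν_j`. -/
def barnesIntegrand (g : ℝ) {n : ℕ} (lam : Fin (n + 1) → ℂ) (y : ℝ) (f : (Fin n → ℂ) → ℂ)
    (t : Fin n → ℝ) : ℂ :=
  let nu : Fin n → ℂ := fun j => Complex.I * (t j : ℂ)
  sklyaninWeight g nu * gammaKernel g lam nu *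
    Complex.exp ((∑ k, lam k - ∑ j, nu j) * (y : ℂ)) * f nu

/-- The integral `∫ μ(ν) K(λ, ν) exp (h(λ, ν) y) f(ν) dν` over `ν ∈ (iℝ)^n`; under `ν = i t` the
complex line element `dν` is `i ^ n dt`. -/
def barnesIntegral (g : ℝ) {n : ℕ} (lam : Fin (n + 1) → ℂ) (y : ℝ) (f : (Fin n → ℂ) → ℂ) : ℂ :=
  Complex.I ^ n * ∫ t : Fin n → ℝ, barnesIntegrand g lam y f t

/-- The function `Φ_λ^{(g)}(x)` for imaginary `λ`, by induction on the number of variables. It is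
`1` for no variables, hence `exp (λ₁ x₁)` for one variable. -/
def Phi (g : ℝ) : (n : ℕ) → (Fin n → ℝ) → (Fin n → ℂ) → ℂ
  | 0, _, _ => 1
  | n + 1, x, lam => barnesIntegral g lam (x (Fin.last n)) (Phi g n (Fin.init x))

/-- The tube `|Re (λ_i - λ_j)| < 2g` around the imaginary space. -/
def spectralTube (g : ℝ) (n : ℕ) : Set (Fin n → ℂ) :=
  {lam | ∀ i j, |(lam i - lam j).re| < 2 * g}

/-- `F` is the analytic continuation of `λ ↦ Φ_λ^{(g)}(x)` from the imaginary space to the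
tube: it is holomorphic in the tube and equal to `Φ` at imaginary `λ`. -/
structure IsPhiContinuation (g : ℝ) (n : ℕ) (x : Fin n → ℝ) (F : (Fin n → ℂ) → ℂ) : Prop where
  holomorphic : DifferentiableOn ℂ F (spectralTube g n)
  eq_Phi : ∀ lam : Fin n → ℂ, (∀ j, (lam j).re = 0) → F lam = Phi g n x lam

end

-- Both sides are brought to Barnes integrals over one contour `Re ν = c`, where they agree
-- pointwise. Since the real parts of the `λ_k` spread over less than `2g - 2`, a real `c` lies
-- within `g` of every `Re λ_k` and every `Re λ_k + 2` (`exists_contour`). After recentring, the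
-- continuation at each shifted argument is an integral over this contour, and the Gamma recurrence
-- turns the shifted kernel into the original one times rational factors
-- (`continuation_shift_eq_integral`).
--
-- On the right, the coefficient of a subset `J` has poles at `ν_i = ν_j`, but its product with `μ`
-- is again a product of reciprocal Gamma functions with shifted arguments, hence entire
-- (`sklyaninWeight_mul_coeff`). The contour can therefore move to `Re ν_j = c - 2` for `j ∈ J` and
-- `Re ν_j = c` otherwise. Substituting `ν_j - 2` for `ν_j` on `J` removes the shift from the
-- argument of `G` and leaves `μ K` times a rational function on `Re ν = c` (`integral_term_eq`).
--
-- What remains is `rational_kernel_identity`. The Cauchy determinant bordered by ones, with entries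
-- replaced by `z (λ_i - a - v_j)⁻¹ + (λ_i - v_j)⁻¹`, can be expanded over the `λ_i` or over the
-- `v_j`. The border then contributes a factor `z + 1` to the second expansion, which is why subsets
-- of size `r - 1` and of size `r` both occur on the right.
--
-- Analytically, Gamma factors decay or grow at rate `π/2` in the imaginary part. The interlacing
-- inequality `sum_max_abs_sub_le` makes the kernel beat the growth of `μ` and reproduces in `λ` the
-- decay assumed in `ν`, so bounds propagate by induction on the number of variables. This gives
-- convergence and holomorphy for `|Re λ_j| < g`. Covariance under common translations extends `Φ`
-- to the tube, and uniqueness there covers every continuation.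

-- Bounds for Gamma and its reciprocal in vertical strips

/-- `‖Γ(σ + iτ)‖ / Γ(σ)` is monotone in `σ > 0`. -/
lemma norm_Gamma_mul_Gamma_le {a b : ℝ} (ha : 0 < a) (hab : a ≤ b) (τ : ℝ) :
    ‖Complex.Gamma (a + τ * Complex.I)‖ * Real.Gamma b ≤
      ‖Complex.Gamma (b + τ * Complex.I)‖ * Real.Gamma a := by
  rcases hab.eq_or_lt with rfl | hlt
  · rfl
  obtain ⟨d, hd, rfl⟩ : ∃ d, 0 < d ∧ b = a + d := ⟨b - a, by linarith, by ring⟩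
  have hre : 0 < ((a : ℂ) + τ * Complex.I).re := by simpa using ha
  have hre' : 0 < (a : ℂ).re := by simpa using ha
  have hd' : 0 < (d : ℂ).re := by simpa using hd
  have h1 := Complex.Gamma_mul_Gamma_eq_betaIntegral hre hd'
  have h2 := Complex.Gamma_mul_Gamma_eq_betaIntegral hre' hd'
  -- Since `|x ^ (iτ)| = 1`, the imaginary part can only decrease the modulus of the Beta integral,
  -- which is `Γ(z) Γ(d) / Γ(z + d)`.
  have hB : ‖Complex.betaIntegral (a + τ * Complex.I) d‖ ≤ ‖Complex.betaIntegral a d‖ := by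
    have hreal : Complex.betaIntegral a d
        = ((∫ x in (0 : ℝ)..1, x ^ (a - 1) * (1 - x) ^ (d - 1) : ℝ) : ℂ) := by
      rw [Complex.betaIntegral, ← intervalIntegral.integral_ofReal]
      refine intervalIntegral.integral_congr fun x hx => ?_
      rw [Set.uIcc_of_le zero_le_one] at hx
      have h0 := hx.1
      have h1 : 0 ≤ 1 - x := by linarith [hx.2]
      simp only [Complex.ofReal_mul, Complex.ofReal_cpow h0, Complex.ofReal_cpow h1]
      push_cast
      rfl
    rw [hreal, Complex.norm_real]
    refine le_trans ?_ (le_abs_self _)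
    refine (intervalIntegral.norm_integral_le_integral_norm zero_le_one).trans_eq ?_
    refine intervalIntegral.integral_congr_ae ?_
    have hne : ∀ᵐ x : ℝ, x ≠ 1 := by simp [ae_iff]
    filter_upwards [hne] with x hx1 hx
    rw [Set.uIoc_of_le zero_le_one] at hx
    have h0 := hx.1
    have h1 : 0 < 1 - x := by linarith [lt_of_le_of_ne hx.2 hx1]
    rw [norm_mul, Complex.norm_cpow_eq_rpow_re_of_pos h0,
      show (1 - (x : ℂ)) = ((1 - x : ℝ) : ℂ) by push_cast; rfl,
      Complex.norm_cpow_eq_rpow_re_of_pos h1]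
    simp
  have e1 := congrArg norm h1
  have e2 := congrArg norm h2
  rw [norm_mul, norm_mul, Complex.Gamma_ofReal, Complex.norm_real,
    Real.norm_of_nonneg (Real.Gamma_pos_of_pos hd).le] at e1
  rw [norm_mul, norm_mul, ← Complex.ofReal_add, Complex.Gamma_ofReal, Complex.Gamma_ofReal,
    Complex.Gamma_ofReal, Complex.norm_real, Complex.norm_real, Complex.norm_real,
    Real.norm_of_nonneg (Real.Gamma_pos_of_pos hd).le,
    Real.norm_of_nonneg (Real.Gamma_pos_of_pos ha).le,
    Real.norm_of_nonneg (Real.Gamma_pos_of_pos (add_pos ha hd)).le] at e2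
  have hs : (a : ℂ) + τ * Complex.I + d = ((a + d : ℝ) : ℂ) + τ * Complex.I := by
    push_cast; ring
  rw [hs] at e1
  have hGd := Real.Gamma_pos_of_pos hd
  refine le_of_mul_le_mul_right ?_ hGd
  calc _ = (‖Complex.Gamma (a + τ * Complex.I)‖ * Real.Gamma d) * Real.Gamma (a + d) := by ring
    _ = ‖Complex.Gamma (((a + d : ℝ) : ℂ) + τ * Complex.I)‖ *
        (Real.Gamma (a + d) * ‖Complex.betaIntegral (a + τ * Complex.I) d‖) := by rw [e1]; ring
    _ ≤ ‖Complex.Gamma (((a + d : ℝ) : ℂ) + τ * Complex.I)‖ *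
        (Real.Gamma (a + d) * ‖Complex.betaIntegral a d‖) := by
        have := (Real.Gamma_pos_of_pos (add_pos ha hd)).le
        gcongr
    _ = _ := by rw [← e2]; ring

/-- On `Re z = 1/2` one has `1 - z = conj z`, so the reflection formula computes a squared modulus.
This line supplies the exact exponential rate; other lines are compared with it. -/
lemma norm_Gamma_half_sq (τ : ℝ) :
    ‖Complex.Gamma (((1 / 2 : ℝ) : ℂ) + τ * Complex.I)‖ ^ 2 = Real.pi / Real.cosh (Real.pi * τ) := by
  have h := Complex.Gamma_mul_Gamma_one_sub (((1 / 2 : ℝ) : ℂ) + τ * Complex.I)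
  have hc : (1 : ℂ) - (((1 / 2 : ℝ) : ℂ) + τ * Complex.I)
      = (starRingEnd ℂ) (((1 / 2 : ℝ) : ℂ) + τ * Complex.I) := by
    simp only [map_add, map_mul, Complex.conj_ofReal, Complex.conj_I]
    push_cast; ring
  have hs : Complex.sin (Real.pi * (((1 / 2 : ℝ) : ℂ) + τ * Complex.I))
      = ((Real.cosh (Real.pi * τ) : ℝ) : ℂ) := by
    rw [show (Real.pi : ℂ) * (((1 / 2 : ℝ) : ℂ) + τ * Complex.I)
      = (Real.pi * τ : ℝ) * Complex.I + Real.pi / 2 by push_cast; ring,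
      Complex.sin_add_pi_div_two, Complex.cos_mul_I, Complex.ofReal_cosh]
  rw [hc, Complex.Gamma_conj, Complex.mul_conj, hs, Complex.normSq_eq_norm_sq] at h
  exact_mod_cast h

lemma norm_Gamma_half_le (τ : ℝ) :
    ‖Complex.Gamma (((1 / 2 : ℝ) : ℂ) + τ * Complex.I)‖
      ≤ Real.sqrt (2 * Real.pi) * Real.exp (-(Real.pi / 2 * |τ|)) := by
  refine le_of_sq_le_sq ?_ (by positivity)
  rw [norm_Gamma_half_sq, mul_pow, Real.sq_sqrt (by positivity), ← Real.exp_nat_mul,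
    div_le_iff₀ (Real.cosh_pos _), ← Real.cosh_abs, abs_mul, abs_of_pos Real.pi_pos, Real.cosh_eq]
  have : Real.exp (((2 : ℕ) : ℝ) * -(Real.pi / 2 * |τ|)) * Real.exp (Real.pi * |τ|) = 1 := by
    rw [← Real.exp_add, ← Real.exp_zero]; congr 1; push_cast; ring
  have h2 : 0 ≤ Real.exp (((2 : ℕ) : ℝ) * -(Real.pi / 2 * |τ|)) * Real.exp (-(Real.pi * |τ|)) := by
    positivity
  nlinarith [Real.pi_pos]

lemma le_norm_Gamma_half (τ : ℝ) :
    Real.exp (-(Real.pi / 2 * |τ|)) ≤ ‖Complex.Gamma (((1 / 2 : ℝ) : ℂ) + τ * Complex.I)‖ := by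
  refine le_of_sq_le_sq ?_ (by positivity)
  rw [norm_Gamma_half_sq, ← Real.exp_nat_mul,
    le_div_iff₀ (Real.cosh_pos _), ← Real.cosh_abs, abs_mul, abs_of_pos Real.pi_pos, Real.cosh_eq]
  have h1 : Real.exp (((2 : ℕ) : ℝ) * -(Real.pi / 2 * |τ|)) * Real.exp (Real.pi * |τ|) = 1 := by
    rw [← Real.exp_add, ← Real.exp_zero]; congr 1; push_cast; ring
  have h2 : Real.exp (((2 : ℕ) : ℝ) * -(Real.pi / 2 * |τ|)) * Real.exp (-(Real.pi * |τ|)) ≤ 1 := by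
    rw [← Real.exp_add, Real.exp_le_one_iff]
    have : 0 ≤ Real.pi * |τ| := by positivity
    push_cast
    linarith
  nlinarith [Real.pi_gt_three]

lemma Gamma_add_nat_eq (m : ℕ) (z : ℂ) (hz : ∀ k : ℕ, z + k ≠ 0) :
    Complex.Gamma (z + m) = (∏ k ∈ Finset.range m, (z + k)) * Complex.Gamma z := by
  induction m with
  | zero => simp
  | succ m ih =>
    rw [Finset.prod_range_succ, Nat.cast_succ, ← add_assoc, Complex.Gamma_add_one _ (hz m), ih]
    ring

lemma inv_Gamma_eq_prod (m : ℕ) (z : ℂ) :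
    (Complex.Gamma z)⁻¹ = (∏ k ∈ Finset.range m, (z + k)) * (Complex.Gamma (z + m))⁻¹ := by
  induction m with
  | zero => simp
  | succ m ih =>
    rw [Finset.prod_range_succ, ih, Complex.one_div_Gamma_eq_self_mul_one_div_Gamma_add_one (z + m),
      Nat.cast_succ, ← add_assoc]
    ring

lemma norm_prod_range_add_le (m : ℕ) (z : ℂ) (B : ℝ) (hz : |z.re| ≤ B) :
    ‖∏ k ∈ Finset.range m, (z + k)‖ ≤ (B + m + 1) ^ m * (1 + |z.im|) ^ m := by
  have hB : 0 ≤ B := (abs_nonneg _).trans hz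
  rw [norm_prod, ← mul_pow]
  refine (Finset.prod_le_prod (fun _ _ => norm_nonneg _)
    (g := fun _ => (B + m + 1) * (1 + |z.im|)) fun k hk => ?_).trans_eq (by simp)
  have hk' : (k : ℝ) ≤ m := by exact_mod_cast (Finset.mem_range.1 hk).le
  calc ‖z + k‖ ≤ ‖z‖ + ‖(k : ℂ)‖ := norm_add_le _ _
    _ ≤ (|z.re| + |z.im|) + k := by
        gcongr
        · exact Complex.norm_le_abs_re_add_abs_im z
        · simp
    _ ≤ _ := by nlinarith [abs_nonneg z.im, mul_nonneg hB (abs_nonneg z.im), Nat.cast_nonneg (α := ℝ) m,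
              mul_nonneg (Nat.cast_nonneg (α := ℝ) m) (abs_nonneg z.im)]

lemma continuousAt_Gamma_of_pos {s : ℝ} (hs : 0 < s) : ContinuousAt Real.Gamma s :=
  (Real.differentiableAt_Gamma fun m => by
    have : (0 : ℝ) ≤ m := Nat.cast_nonneg m
    linarith).continuousAt

/-- Uniform decay of the Gamma function in vertical strips to the right of the origin. -/
lemma exists_norm_Gamma_le (δ B : ℝ) (hδ : 0 < δ) :
    ∃ C : ℝ, ∃ A : ℕ, 0 ≤ C ∧ ∀ z : ℂ, δ ≤ z.re → z.re ≤ B →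
      ‖Complex.Gamma z‖ ≤ C * (1 + |z.im|) ^ A * Real.exp (-(Real.pi / 2 * |z.im|)) := by
  -- Monotonicity moves `Re z` right to `1/2 + m`, and the recurrence returns to `1/2` at polynomial
  -- cost.
  obtain ⟨m, hm⟩ := exists_nat_ge B
  have hcont : ContinuousOn Real.Gamma (Set.Icc δ B) := fun s hs =>
    (continuousAt_Gamma_of_pos (hδ.trans_le hs.1)).continuousWithinAt
  obtain ⟨G, hG⟩ := (isCompact_Icc.bddAbove_image hcont)
  have hb : 0 < (1 / 2 : ℝ) + m := by positivity
  have hΓ := Real.Gamma_pos_of_pos hb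
  refine ⟨max G 0 / Real.Gamma (1 / 2 + m) * (1 / 2 + m + 1) ^ m * Real.sqrt (2 * Real.pi), m,
    by positivity, fun z h1 h2 => ?_⟩
  have hzpos := hδ.trans_le h1
  have hmono := norm_Gamma_mul_Gamma_le hzpos (show z.re ≤ 1 / 2 + m by linarith) z.im
  rw [Complex.re_add_im] at hmono
  have hsh : (((1 / 2 + m : ℝ) : ℂ) + z.im * Complex.I)
      = (((1 / 2 : ℝ) : ℂ) + z.im * Complex.I) + m := by push_cast; ring
  rw [hsh, Gamma_add_nat_eq, norm_mul] at hmono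
  swap
  · intro k hk
    have := congrArg Complex.re hk
    simp at this
    have hk0 : (0 : ℝ) ≤ k := Nat.cast_nonneg k
    norm_num at this
    linarith
  have hp := norm_prod_range_add_le m (((1 / 2 : ℝ) : ℂ) + z.im * Complex.I) (1 / 2) (by
    norm_num)
  have him : (((1 / 2 : ℝ) : ℂ) + z.im * Complex.I).im = z.im := by simp
  rw [him] at hp
  have hGz : Real.Gamma z.re ≤ max G 0 := le_max_of_le_left (hG ⟨z.re, ⟨h1, h2⟩, rfl⟩)
  have hh := norm_Gamma_half_le z.im
  have key : ‖Complex.Gamma z‖ * Real.Gamma (1 / 2 + m) ≤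
      (((1 / 2 + m + 1) ^ m * (1 + |z.im|) ^ m) *
        (Real.sqrt (2 * Real.pi) * Real.exp (-(Real.pi / 2 * |z.im|)))) * max G 0 := by
    refine hmono.trans ?_
    have := (Real.Gamma_pos_of_pos hzpos).le
    gcongr
  rw [← le_div_iff₀ hΓ] at key
  refine key.trans_eq ?_
  ring

/-- Uniform growth of the reciprocal Gamma function in vertical strips. -/
lemma exists_norm_inv_Gamma_le (B : ℝ) :
    ∃ C : ℝ, ∃ A : ℕ, 0 ≤ C ∧ ∀ z : ℂ, |z.re| ≤ B →
      ‖(Complex.Gamma z)⁻¹‖ ≤ C * (1 + |z.im|) ^ A * Real.exp (Real.pi / 2 * |z.im|) := by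
  -- With this `m`, `Re z + m ≥ 1/2`, so monotonicity bounds `Γ(z + m)` below by its modulus on the
  -- line `1/2`.
  obtain ⟨m, hm⟩ := exists_nat_ge (B + 1 / 2)
  have hpos : ∀ s ∈ Set.Icc (1 / 2 : ℝ) (B + m), 0 < s := fun s hs =>
    lt_of_lt_of_le (by norm_num) hs.1
  have hcont : ContinuousOn (fun s => (Real.Gamma s)⁻¹) (Set.Icc (1 / 2) (B + m)) := fun s hs =>
    ((continuousAt_Gamma_of_pos (hpos s hs)).inv₀
      (Real.Gamma_pos_of_pos (hpos s hs)).ne').continuousWithinAt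
  obtain ⟨G, hG⟩ := (isCompact_Icc.bddAbove_image hcont)
  have hhalf := Real.Gamma_pos_of_pos (show (0 : ℝ) < 1 / 2 by norm_num)
  refine ⟨(|B| + m + 1) ^ m * (Real.Gamma (1 / 2) * max G 0), m, by positivity, fun z hz => ?_⟩
  obtain ⟨hz1, hz2⟩ := abs_le.1 hz
  have hlow : (1 / 2 : ℝ) ≤ z.re + m := by linarith
  have hmem : z.re + m ∈ Set.Icc (1 / 2 : ℝ) (B + m) := ⟨hlow, by linarith⟩
  have hmono := norm_Gamma_mul_Gamma_le (show (0 : ℝ) < 1 / 2 by norm_num) hlow z.im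
  have hsh : (((z.re + m : ℝ) : ℂ) + z.im * Complex.I) = z + m := by
    apply Complex.ext <;> simp
  rw [hsh] at hmono
  have hGz : (Real.Gamma (z.re + m))⁻¹ ≤ max G 0 := le_max_of_le_left (hG ⟨_, hmem, rfl⟩)
  have hΓz := Real.Gamma_pos_of_pos (hpos _ hmem)
  have hp := norm_prod_range_add_le m z |B| (hz.trans (le_abs_self _))
  have hle := le_norm_Gamma_half z.im
  have hzp : 0 < ‖Complex.Gamma (z + m)‖ := by
    have : 0 < ‖Complex.Gamma (z + m)‖ * Real.Gamma (1 / 2) :=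
      lt_of_lt_of_le (mul_pos ((Real.exp_pos _).trans_le hle) hΓz) hmono
    exact pos_of_mul_pos_left this hhalf.le
  have hinv : ‖(Complex.Gamma (z + m))⁻¹‖ ≤
      Real.Gamma (1 / 2) * max G 0 * Real.exp (Real.pi / 2 * |z.im|) := by
    rw [norm_inv, inv_le_comm₀ hzp (by
      have : 0 < max G 0 := (inv_pos.2 hΓz).trans_le hGz
      positivity)]
    rw [mul_inv, mul_inv, ← Real.exp_neg]
    have h3 : (max G 0)⁻¹ ≤ Real.Gamma (z.re + m) := inv_le_of_inv_le₀ hΓz hGz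
    calc (Real.Gamma (1 / 2))⁻¹ * (max G 0)⁻¹ * Real.exp (-(Real.pi / 2 * |z.im|))
        ≤ (Real.Gamma (1 / 2))⁻¹ * Real.Gamma (z.re + m) *
          ‖Complex.Gamma (((1 / 2 : ℝ) : ℂ) + z.im * Complex.I)‖ := by gcongr
      _ = (Real.Gamma (1 / 2))⁻¹ * (‖Complex.Gamma (((1 / 2 : ℝ) : ℂ) + z.im * Complex.I)‖ *
          Real.Gamma (z.re + m)) := by ring
      _ ≤ (Real.Gamma (1 / 2))⁻¹ * (‖Complex.Gamma (z + m)‖ * Real.Gamma (1 / 2)) := by gcongr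
      _ = _ := by field_simp
  rw [inv_Gamma_eq_prod m z, norm_mul]
  calc _ ≤ ((|B| + m + 1) ^ m * (1 + |z.im|) ^ m) *
        (Real.Gamma (1 / 2) * max G 0 * Real.exp (Real.pi / 2 * |z.im|)) := by gcongr
    _ = _ := by ring

-- The rational kernel identity from a bordered Cauchy determinant

lemma sum_pow_card_coeff {ι : Type*} [Fintype ι] (D : Finset ι → ℂ) (r : ℕ) :
    (∑ s : Finset ι, Polynomial.C (D s) * Polynomial.X ^ s.card).coeff r
      = ∑ s ∈ (Finset.univ : Finset ι).powersetCard r, D s := by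
  classical
  rw [Polynomial.finsetSum_coeff]
  simp only [Polynomial.coeff_C_mul_X_pow]
  rw [← Finset.sum_filter]
  refine Finset.sum_congr ?_ fun _ _ => rfl
  ext s
  simp [Finset.mem_powersetCard, eq_comm]

/-- The Cauchy determinant bordered by a row of ones. -/
noncomputable def borderedCauchyDet {n : ℕ} (lam : Fin (n + 1) → ℂ) (v : Fin n → ℂ) : ℂ :=
  (Matrix.of (Fin.snoc (α := fun _ => Fin (n + 1) → ℂ) (fun j i => (lam i - v j)⁻¹)
    (fun _ => 1))).det

/-- Each `λ_i` occurs in a single column, so multilinearity over the columns expands the right-hand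
determinant over the set of shifted nodes. -/
lemma sum_borderedCauchyDet_left {n : ℕ} (lam : Fin (n + 1) → ℂ) (v : Fin n → ℂ) (a z : ℂ) :
    ∑ s : Finset (Fin (n + 1)), z ^ s.card *
        borderedCauchyDet (fun i => if i ∈ s then lam i - a else lam i) v =
      (Matrix.of (Fin.snoc (α := fun _ => Fin (n + 1) → ℂ)
        (fun j i => z * (lam i - a - v j)⁻¹ + (lam i - v j)⁻¹) (fun _ => z + 1))).det := by
  let row : ℂ → Fin (n + 1) → ℂ := fun x => Fin.snoc (α := fun _ => ℂ) (fun j => (x - v j)⁻¹) 1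
  have h := (Matrix.detRowAlternating (n := Fin (n + 1)) (R := ℂ)).toMultilinearMap.map_add_univ
    (fun i => z • row (lam i - a)) (fun i => row (lam i))
  have hD : ∀ mu : Fin (n + 1) → ℂ, borderedCauchyDet mu v
      = Matrix.detRowAlternating (fun i => row (mu i)) := by
    intro mu
    rw [borderedCauchyDet, ← Matrix.det_transpose]
    change Matrix.det _ = Matrix.det _
    congr 1
    ext i j
    refine Fin.lastCases ?_ (fun j => ?_) j <;> simp [row]
  have e : (Matrix.of (Fin.snoc (α := fun _ => Fin (n + 1) → ℂ)
        (fun j i => z * (lam i - a - v j)⁻¹ + (lam i - v j)⁻¹) (fun _ => z + 1))).det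
      = Matrix.detRowAlternating.toMultilinearMap
        ((fun i => z • row (lam i - a)) + (fun i => row (lam i))) := by
    rw [← Matrix.det_transpose]
    change Matrix.det _ = Matrix.det _
    congr 1
    ext i j
    refine Fin.lastCases ?_ (fun j => ?_) j <;> simp [row]
  rw [e, h]
  refine Finset.sum_congr rfl fun s _ => ?_
  have hs := (Matrix.detRowAlternating (n := Fin (n + 1)) (R := ℂ)).toMultilinearMap.map_piecewise_smul
    (fun _ => z) (s.piecewise (fun i => row (lam i - a)) (fun i => row (lam i))) s
  rw [Finset.prod_const, smul_eq_mul] at hs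
  rw [hD]
  have e1 : (fun i => row (if i ∈ s then lam i - a else lam i))
      = s.piecewise (fun i => row (lam i - a)) (fun i => row (lam i)) := by
    ext i j; by_cases hi : i ∈ s <;> simp [hi]
  have e2 : s.piecewise (fun i => z • row (lam i - a)) (fun i => row (lam i))
      = s.piecewise (fun i => z • s.piecewise (fun i => row (lam i - a)) (fun i => row (lam i)) i)
        (s.piecewise (fun i => row (lam i - a)) (fun i => row (lam i))) := by
    ext i j; by_cases hi : i ∈ s <;> simp [hi]
  rw [e1, e2]
  exact hs.symm

/-- In `λ_i - a - v_j` the shift may equally be charged to `v_j`, so the same matrix expands over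
its first `n` rows. `curryRight` isolates the border row, a multiple `z + 1` of the row of ones. -/
lemma sum_borderedCauchyDet_right {n : ℕ} (lam : Fin (n + 1) → ℂ) (v : Fin n → ℂ) (a z : ℂ) :
    (z + 1) * ∑ s : Finset (Fin n), z ^ s.card *
        borderedCauchyDet lam (fun j => if j ∈ s then v j + a else v j) =
      (Matrix.of (Fin.snoc (α := fun _ => Fin (n + 1) → ℂ)
        (fun j i => z * (lam i - a - v j)⁻¹ + (lam i - v j)⁻¹) (fun _ => z + 1))).det := by
  let col : ℂ → Fin (n + 1) → ℂ := fun x i => (lam i - x)⁻¹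
  let f := (Matrix.detRowAlternating (n := Fin (n + 1)) (R := ℂ)).toMultilinearMap.curryRight
  have hD : ∀ w : Fin n → ℂ, borderedCauchyDet lam w = f (fun j => col (w j)) 1 := fun w => rfl
  have e : (Matrix.of (Fin.snoc (α := fun _ => Fin (n + 1) → ℂ)
        (fun j i => z * (lam i - a - v j)⁻¹ + (lam i - v j)⁻¹) (fun _ => z + 1))).det
      = f ((fun j => z • col (v j + a)) + (fun j => col (v j))) ((z + 1) • 1) := by
    rw [MultilinearMap.curryRight_apply]
    change Matrix.det _ = Matrix.det _
    congr 1
    ext j i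
    refine Fin.lastCases ?_ (fun j => ?_) j
    · simp
    · simp [col, sub_sub, add_comm]
  rw [e, f.map_add_univ, map_smul, LinearMap.sum_apply, smul_eq_mul]
  congr 1
  refine Finset.sum_congr rfl fun s _ => ?_
  have hs := f.map_piecewise_smul
    (fun _ => z) (s.piecewise (fun i => col (v i + a)) (fun i => col (v i))) s
  rw [Finset.prod_const] at hs
  have e1 : (fun i => col (if i ∈ s then v i + a else v i))
      = s.piecewise (fun i => col (v i + a)) (fun i => col (v i)) := by
    ext i j; by_cases hi : i ∈ s <;> simp [hi]
  have e2 : s.piecewise (fun i => z • col (v i + a)) (fun i => col (v i))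
      = s.piecewise (fun i => z • s.piecewise (fun i => col (v i + a)) (fun i => col (v i)) i)
        (s.piecewise (fun i => col (v i + a)) (fun i => col (v i))) := by
    ext i j; by_cases hi : i ∈ s <;> simp [hi]
  rw [hD, e1, e2, hs]
  rfl

/-- Compare coefficients of `z ^ (r + 1)` in the two expansions; the factor `z + 1` produces both
cardinalities. -/
lemma sum_card_borderedCauchyDet {n : ℕ} (lam : Fin (n + 1) → ℂ) (v : Fin n → ℂ) (a : ℂ) (r : ℕ) :
    ∑ s ∈ (Finset.univ : Finset (Fin (n + 1))).powersetCard (r + 1),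
        borderedCauchyDet (fun i => if i ∈ s then lam i - a else lam i) v =
      ∑ s ∈ (Finset.univ : Finset (Fin n)).powersetCard (r + 1),
        borderedCauchyDet lam (fun j => if j ∈ s then v j + a else v j) +
      ∑ s ∈ (Finset.univ : Finset (Fin n)).powersetCard r,
        borderedCauchyDet lam (fun j => if j ∈ s then v j + a else v j) := by
  have hpoly : ∑ s : Finset (Fin (n + 1)), Polynomial.C
        (borderedCauchyDet (fun i => if i ∈ s then lam i - a else lam i) v) *
          Polynomial.X ^ s.card =
      (Polynomial.X + 1) * ∑ s : Finset (Fin n), Polynomial.C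
        (borderedCauchyDet lam (fun j => if j ∈ s then v j + a else v j)) *
          Polynomial.X ^ s.card := by
    refine Polynomial.funext fun z => ?_
    simp only [Polynomial.eval_finsetSum, Polynomial.eval_mul, Polynomial.eval_C,
      Polynomial.eval_pow, Polynomial.eval_X, Polynomial.eval_add, Polynomial.eval_one]
    have := (sum_borderedCauchyDet_left lam v a z).trans
      (sum_borderedCauchyDet_right lam v a z).symm
    simpa only [mul_comm (z ^ _)] using this
  have := congrArg (fun p => p.coeff (r + 1)) hpoly
  simp only [add_mul, one_mul, Polynomial.coeff_add, Polynomial.coeff_X_mul,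
    sum_pow_card_coeff] at this
  rw [this, add_comm]

/-- The polynomials whose values are the entries of the bordered Cauchy matrix, after clearing
denominators. -/
noncomputable def cauchyPoly {n : ℕ} (v : Fin n → ℂ) : Fin (n + 1) → Polynomial ℂ :=
  Fin.snoc (α := fun _ => Polynomial ℂ)
    (fun j => ∏ b ∈ Finset.univ.erase j, (Polynomial.X - Polynomial.C (v b)))
    (∏ b, (Polynomial.X - Polynomial.C (v b)))

lemma natDegree_cauchyPoly_lt {n : ℕ} (v : Fin n → ℂ) (j : Fin (n + 1)) :
    (cauchyPoly v j).natDegree < n + 1 := by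
  refine Fin.lastCases ?_ (fun j => ?_) j <;>
    simp [cauchyPoly, Polynomial.natDegree_finsetProd_X_sub_C_eq_card]

/-- Polynomials of degree at most `n` have values equal to Vandermonde times coefficients. The
coefficient determinant does not involve `lam`, so one convenient choice of nodes determines it. -/
lemma eval_cauchyPoly_det {n : ℕ} (v : Fin n → ℂ) (lam : Fin (n + 1) → ℂ) :
    (Matrix.of fun i j => (cauchyPoly v j).eval (lam i)).det =
      (Matrix.vandermonde lam).det *
        (Matrix.of fun (k : Fin (n + 1)) j => (cauchyPoly v j).coeff k).det := by
  rw [← Matrix.det_mul]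
  congr 1
  ext i j
  rw [Matrix.mul_apply, Matrix.of_apply,
    Polynomial.eval_eq_sum_range' (natDegree_cauchyPoly_lt v j), Finset.sum_range]
  refine Finset.sum_congr rfl fun k _ => ?_
  rw [Matrix.vandermonde_apply, Matrix.of_apply, mul_comm]

/-- Evaluate at the nodes `v` together with one auxiliary point `x` outside their range. All
polynomials except the `i`-th vanish at `v i`, so the matrix is triangular, and the factor `∏ (x - v
j)` cancels. -/
lemma coeff_cauchyPoly_det {n : ℕ} (v : Fin n → ℂ) :
    (Matrix.vandermonde v).det *
      (Matrix.of fun (k : Fin (n + 1)) j => (cauchyPoly v j).coeff k).det =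
      ∏ i, ∏ j ∈ Finset.univ.erase i, (v i - v j) := by
  obtain ⟨x, hx⟩ := (Set.finite_range v).infinite_compl.nonempty
  have hx' : ∀ j, x - v j ≠ 0 := fun j h => hx ⟨j, (sub_eq_zero.1 h).symm⟩
  have hxp : ∏ j, (x - v j) ≠ 0 := Finset.prod_ne_zero_iff.2 fun j _ => hx' j
  have h := eval_cauchyPoly_det v (Fin.snoc (α := fun _ => ℂ) v x)
  have hV : (Matrix.vandermonde (Fin.snoc (α := fun _ => ℂ) v x)).det
      = (Matrix.vandermonde v).det * ∏ j, (x - v j) := by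
    rw [Matrix.det_vandermonde, Matrix.det_vandermonde, Fin.prod_univ_castSucc,
      ← Finset.prod_mul_distrib]
    have hl : Finset.Ioi (Fin.last n) = ∅ := by
      ext i; simp [Fin.le_last]
    rw [hl, Finset.prod_empty, mul_one]
    refine Finset.prod_congr rfl fun i _ => ?_
    have hI : Finset.Ioi (Fin.castSucc i)
        = insert (Fin.last n) ((Finset.Ioi i).map Fin.castSuccEmb) := by
      ext k
      refine Fin.lastCases ?_ (fun k => ?_) k
      · simp [Fin.castSucc_lt_last]
      · simp [Fin.le_last]
    rw [hI, Finset.prod_insert (by simp), Finset.prod_map]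
    simp [mul_comm]
  have hT : (Matrix.of fun i j => (cauchyPoly v j).eval (Fin.snoc (α := fun _ => ℂ) v x i)).det
      = (∏ i, ∏ j ∈ Finset.univ.erase i, (v i - v j)) * ∏ j, (x - v j) := by
    rw [Matrix.det_of_isLowerTriangular]
    · rw [Fin.prod_univ_castSucc]
      simp [cauchyPoly, Polynomial.eval_prod]
    · intro i j hij
      rw [OrderDual.toDual_lt_toDual] at hij
      rw [Matrix.of_apply]
      revert hij
      refine Fin.lastCases ?_ (fun i => ?_) i
      · intro hij; exact absurd hij (Fin.le_last j).not_gt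
      · refine Fin.lastCases ?_ (fun j => ?_) j
        · intro _
          simp only [cauchyPoly, Fin.snoc_last, Fin.snoc_castSucc, Polynomial.eval_prod]
          exact Finset.prod_eq_zero (Finset.mem_univ i) (by simp)
        · intro hij
          simp only [cauchyPoly, Fin.snoc_castSucc, Polynomial.eval_prod]
          refine Finset.prod_eq_zero (Finset.mem_erase.2 ⟨?_, Finset.mem_univ i⟩) (by simp)
          rintro rfl
          exact lt_irrefl _ hij
  rw [hT, hV] at h
  refine mul_right_cancel₀ hxp (h.trans ?_).symm
  ring

lemma borderedCauchyDet_mul {n : ℕ} (lam : Fin (n + 1) → ℂ) (v : Fin n → ℂ)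
    (h : ∀ k j, lam k - v j ≠ 0) :
    (∏ k, ∏ j, (lam k - v j)) * borderedCauchyDet lam v =
      (Matrix.vandermonde lam).det *
        (Matrix.of fun (k : Fin (n + 1)) j => (cauchyPoly v j).coeff k).det := by
  rw [← eval_cauchyPoly_det, borderedCauchyDet, ← Matrix.det_transpose, ← Matrix.det_mul_column]
  congr 1
  ext i j
  simp only [Matrix.of_apply, Matrix.transpose_apply]
  refine Fin.lastCases ?_ (fun j => ?_) j
  · simp [cauchyPoly, Polynomial.eval_prod]
  · simp only [Fin.snoc_castSucc, cauchyPoly, Polynomial.eval_prod, Polynomial.eval_sub,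
      Polynomial.eval_X, Polynomial.eval_C]
    rw [← Finset.mul_prod_erase _ _ (Finset.mem_univ j)]
    field_simp [h i j]

lemma prod_prod_erase_sub {n : ℕ} (v : Fin n → ℂ) :
    ∏ i, ∏ j ∈ Finset.univ.erase i, (v i - v j) =
      (∏ i : Fin n, ∏ _j ∈ Finset.Ioi i, (-1 : ℂ)) * (Matrix.vandermonde v).det ^ 2 := by
  have := Finset.prod_prod_Ioi_mul_eq_prod_prod_off_diag (fun i j => v j - v i)
  simp only [← Finset.compl_singleton] at *
  rw [← this, Matrix.det_vandermonde, ← Finset.prod_pow, ← Finset.prod_mul_distrib]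
  refine Finset.prod_congr rfl fun i _ => ?_
  rw [← Finset.prod_pow, ← Finset.prod_mul_distrib]
  refine Finset.prod_congr rfl fun j _ => ?_
  ring

/-- Evaluation of the bordered Cauchy determinant. -/
lemma borderedCauchyDet_eq {n : ℕ} (lam : Fin (n + 1) → ℂ) (v : Fin n → ℂ)
    (h : ∀ k j, lam k - v j ≠ 0) :
    (∏ k, ∏ j, (lam k - v j)) * borderedCauchyDet lam v =
      (∏ i : Fin n, ∏ _j ∈ Finset.Ioi i, (-1 : ℂ)) *
        ((Matrix.vandermonde lam).det * (Matrix.vandermonde v).det) := by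
  -- For distinct `v` the Vandermonde determinant of `v` is cancelled; otherwise both sides vanish,
  -- the left one because two rows coincide.
  by_cases hv : Function.Injective v
  · have hV : (Matrix.vandermonde v).det ≠ 0 := Matrix.det_vandermonde_ne_zero_iff.2 hv
    rw [borderedCauchyDet_mul lam v h]
    have := coeff_cauchyPoly_det v
    rw [prod_prod_erase_sub] at this
    refine mul_left_cancel₀ hV ?_
    linear_combination (Matrix.vandermonde lam).det * this
  · have hV : (Matrix.vandermonde v).det = 0 := by
      by_contra hne
      exact hv (Matrix.det_vandermonde_ne_zero_iff.1 hne)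
    rw [hV, mul_zero, mul_zero]
    obtain ⟨i, j, hij, hne⟩ : ∃ i j, v i = v j ∧ i ≠ j := by
      simpa [Function.Injective] using hv
    rw [borderedCauchyDet, Matrix.det_zero_of_row_eq (i := i.castSucc) (j := j.castSucc), mul_zero]
    · simpa using hne
    · ext k; simp [hij]

/-- The effect on a Vandermonde determinant of shifting the nodes in `s` by `a`. -/
lemma vandermonde_shift {n : ℕ} (v : Fin n → ℂ) (hv : Function.Injective v) (a : ℂ)
    (s : Finset (Fin n)) :
    (Matrix.vandermonde fun j => if j ∈ s then v j + a else v j).det =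
      (Matrix.vandermonde v).det * ∏ i ∈ s, ∏ j ∈ sᶜ, (v i - v j + a) / (v i - v j) := by
  have hne : ∀ i j, i ≠ j → v i - v j ≠ 0 := fun i j hij h => hij (hv (sub_eq_zero.1 h))
  -- Extending the factors by `1` to all ordered pairs permits a comparison with the Vandermonde
  -- product pair by pair; only pairs separated by `s` change.
  let ψ : Fin n → Fin n → ℂ := fun j i =>
    if i ∈ s ∧ j ∉ s then (v i - v j + a) / (v i - v j) else 1
  have h1 : ∏ i ∈ s, ∏ j ∈ sᶜ, (v i - v j + a) / (v i - v j)
      = ∏ i, ∏ j ∈ ({i} : Finset (Fin n))ᶜ, ψ j i := by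
    rw [← Finset.prod_subset (Finset.subset_univ s)]
    · refine Finset.prod_congr rfl fun i hi => ?_
      have hsub : sᶜ ⊆ ({i} : Finset (Fin n))ᶜ := by
        simpa using hi
      rw [← Finset.prod_subset hsub]
      · refine Finset.prod_congr rfl fun j hj => ?_
        simp [ψ, hi, Finset.mem_compl.1 hj]
      · intro j _ hj
        simp only [Finset.mem_compl, not_not] at hj
        simp [ψ, hj]
    · intro i _ hi
      exact Finset.prod_eq_one fun j _ => by simp [ψ, hi]
  rw [h1, ← Finset.prod_prod_Ioi_mul_eq_prod_prod_off_diag, Matrix.det_vandermonde,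
    Matrix.det_vandermonde, ← Finset.prod_mul_distrib]
  refine Finset.prod_congr rfl fun i _ => ?_
  rw [← Finset.prod_mul_distrib]
  refine Finset.prod_congr rfl fun j hj => ?_
  have hij : j ≠ i := (Finset.mem_Ioi.1 hj).ne'
  have d1 := hne _ _ hij
  have d2 := hne _ _ hij.symm
  by_cases hi : i ∈ s <;> by_cases hj' : j ∈ s <;> simp only [ψ, hi, hj', if_true, if_false,
    not_true, not_false_iff, and_true, and_false, mul_one, one_mul]
  · ring
  · field_simp
    ring
  · field_simp
    ring

lemma prod_prod_ite_shift {m n : ℕ} (lam lam' : Fin m → ℂ) (v : Fin n → ℂ) (s : Finset (Fin m))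
    (φ : ℂ → ℂ) (hφ : ∀ i j, φ (lam i - v j) ≠ 0)
    (h : ∀ i, i ∉ s → lam' i = lam i) :
    ∏ k, ∏ j, φ (lam' k - v j) =
      (∏ k, ∏ j, φ (lam k - v j)) * ∏ i ∈ s, ∏ j, φ (lam' i - v j) / φ (lam i - v j) := by
  have hs : ∏ i ∈ s, ∏ j, φ (lam' i - v j) / φ (lam i - v j)
      = ∏ i, ∏ j, φ (lam' i - v j) / φ (lam i - v j) :=
    Finset.prod_subset (Finset.subset_univ s) fun i _ hi =>
      Finset.prod_eq_one fun j _ => by rw [h i hi, div_self (hφ i j)]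
  rw [hs, ← Finset.prod_mul_distrib]
  refine Finset.prod_congr rfl fun k _ => ?_
  rw [← Finset.prod_mul_distrib]
  refine Finset.prod_congr rfl fun j _ => ?_
  rw [mul_div_cancel₀ _ (hφ k j)]

/-- The rational kernel function identity intertwining the Macdonald type sums in `n + 1` and in
`n` variables. -/
theorem rational_kernel_identity {n : ℕ} (lam : Fin (n + 1) → ℂ) (v : Fin n → ℂ) (a : ℂ) (r : ℕ)
    (hl : Function.Injective lam) (hv : Function.Injective v)
    (h0 : ∀ k j, lam k - v j ≠ 0) (h1 : ∀ k j, lam k - v j - a ≠ 0) :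
    ∑ s ∈ (Finset.univ : Finset (Fin (n + 1))).powersetCard (r + 1),
        (∏ i ∈ s, ∏ j ∈ sᶜ, (lam i - lam j - a) / (lam i - lam j)) *
          ∏ i ∈ s, ∏ j, (lam i - v j) / (lam i - v j - a) =
      ∑ s ∈ (Finset.univ : Finset (Fin n)).powersetCard (r + 1),
        (∏ i ∈ s, ∏ j ∈ sᶜ, (v i - v j + a) / (v i - v j)) *
          ∏ j ∈ s, ∏ k, (lam k - v j) / (lam k - v j - a) +
      ∑ s ∈ (Finset.univ : Finset (Fin n)).powersetCard r,
        (∏ i ∈ s, ∏ j ∈ sᶜ, (v i - v j + a) / (v i - v j)) *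
          ∏ j ∈ s, ∏ k, (lam k - v j) / (lam k - v j - a) := by
  have hP : ∏ k, ∏ j, (lam k - v j) ≠ 0 :=
    Finset.prod_ne_zero_iff.2 fun k _ => Finset.prod_ne_zero_iff.2 fun j _ => h0 k j
  have hD := borderedCauchyDet_eq lam v h0
  have hsgn : (∏ i : Fin n, ∏ _j ∈ Finset.Ioi i, (-1 : ℂ)) ≠ 0 :=
    Finset.prod_ne_zero_iff.2 fun k _ => Finset.prod_ne_zero_iff.2 fun j _ => by norm_num
  have hD0 : borderedCauchyDet lam v ≠ 0 := by
    intro h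
    rw [h, mul_zero] at hD
    exact mul_ne_zero hsgn (mul_ne_zero (Matrix.det_vandermonde_ne_zero_iff.2 hl)
      (Matrix.det_vandermonde_ne_zero_iff.2 hv)) hD.symm
  -- In the quotient of shifted by unshifted determinant, the Vandermonde factors give the
  -- difference coefficients and the cross products give the remaining fractions.
  have hL : ∀ s : Finset (Fin (n + 1)),
      borderedCauchyDet (fun i => if i ∈ s then lam i - a else lam i) v =
      borderedCauchyDet lam v * ((∏ i ∈ s, ∏ j ∈ sᶜ, (lam i - lam j - a) / (lam i - lam j)) *
          ∏ i ∈ s, ∏ j, (lam i - v j) / (lam i - v j - a)) := by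
    intro s
    have hsh : ∀ k j, (if k ∈ s then lam k - a else lam k) - v j ≠ 0 := by
      intro k j
      split_ifs
      · rw [sub_right_comm]; exact h1 k j
      · exact h0 k j
    have hP' : ∏ k, ∏ j, ((if k ∈ s then lam k - a else lam k) - v j) ≠ 0 :=
      Finset.prod_ne_zero_iff.2 fun k _ => Finset.prod_ne_zero_iff.2 fun j _ => hsh k j
    have e1 := borderedCauchyDet_eq (fun i => if i ∈ s then lam i - a else lam i) v hsh
    have e2 := vandermonde_shift lam hl (-a) s
    simp only [← sub_eq_add_neg] at e2
    have e3 := prod_prod_ite_shift (fun k => if k ∈ s then lam k - a else lam k) lam v s id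
      hsh (fun i hi => by simp [hi])
    have e4 : ∏ i ∈ s, ∏ j, id (lam i - v j) / id ((if i ∈ s then lam i - a else lam i) - v j)
        = ∏ i ∈ s, ∏ j, (lam i - v j) / (lam i - v j - a) :=
      Finset.prod_congr rfl fun i hi => Finset.prod_congr rfl fun j _ => by
        simp [hi, sub_right_comm]
    rw [e4] at e3
    simp only [id] at e3
    refine mul_left_cancel₀ hP' ?_
    rw [e1, e2]
    linear_combination (-(∏ i ∈ s, ∏ j ∈ sᶜ, (lam i - lam j - a) / (lam i - lam j))) * hD +
      (∏ i ∈ s, ∏ j ∈ sᶜ, (lam i - lam j - a) / (lam i - lam j)) * borderedCauchyDet lam v * e3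
  have hR : ∀ s : Finset (Fin n),
      borderedCauchyDet lam (fun j => if j ∈ s then v j + a else v j) =
      borderedCauchyDet lam v * ((∏ i ∈ s, ∏ j ∈ sᶜ, (v i - v j + a) / (v i - v j)) *
          ∏ j ∈ s, ∏ k, (lam k - v j) / (lam k - v j - a)) := by
    intro s
    have hsh : ∀ k j, lam k - (if j ∈ s then v j + a else v j) ≠ 0 := by
      intro k j
      split_ifs
      · rw [← sub_sub]; exact h1 k j
      · exact h0 k j
    have hP' : ∏ k, ∏ j, (lam k - (if j ∈ s then v j + a else v j)) ≠ 0 :=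
      Finset.prod_ne_zero_iff.2 fun k _ => Finset.prod_ne_zero_iff.2 fun j _ => hsh k j
    have e1 := borderedCauchyDet_eq lam (fun i => if i ∈ s then v i + a else v i) hsh
    have e2 := vandermonde_shift v hv a s
    -- Negation turns `v - lam` into `lam - v`, so the lemma also serves for shifts of `v`.
    have e3 := prod_prod_ite_shift (fun k => if k ∈ s then v k + a else v k) v lam s (fun x => -x)
      (fun j k => by rw [neg_sub]; exact hsh k j) (fun i hi => by simp [hi])
    have e4 : ∏ j ∈ s, ∏ k, (-(v j - lam k)) / (-((if j ∈ s then v j + a else v j) - lam k))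
        = ∏ j ∈ s, ∏ k, (lam k - v j) / (lam k - v j - a) :=
      Finset.prod_congr rfl fun i hi => Finset.prod_congr rfl fun j _ => by
        simp [hi, sub_sub]
    rw [e4] at e3
    simp only [neg_sub] at e3
    rw [Finset.prod_comm, Finset.prod_comm (f := fun j k => lam k - _)] at e3
    refine mul_left_cancel₀ hP' ?_
    rw [e1, e2]
    linear_combination (-(∏ i ∈ s, ∏ j ∈ sᶜ, (v i - v j + a) / (v i - v j))) * hD +
      (∏ i ∈ s, ∏ j ∈ sᶜ, (v i - v j + a) / (v i - v j)) * borderedCauchyDet lam v * e3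
  have key := sum_card_borderedCauchyDet lam v a r
  simp only [hL, hR, ← Finset.mul_sum, ← mul_add] at key
  exact mul_left_cancel₀ hD0 key

-- Interlacing inequality and domination of the integrand

/-- The polynomial weight `∏ (1 + |t_j|)`. -/
noncomputable def polyGrowth {n : ℕ} (t : Fin n → ℝ) : ℝ := ∏ j, (1 + |t j|)

/-- The sum of the distances over all ordered pairs of coordinates. -/
noncomputable def spread {n : ℕ} (t : Fin n → ℝ) : ℝ := ∑ a, ∑ b, |t a - t b|

lemma one_le_polyGrowth {n : ℕ} (t : Fin n → ℝ) : 1 ≤ polyGrowth t := by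
  have : ∏ _j : Fin n, (1 : ℝ) ≤ polyGrowth t :=
    Finset.prod_le_prod (fun _ _ => zero_le_one) fun j _ => by linarith [abs_nonneg (t j)]
  simpa using this

lemma polyGrowth_pos {n : ℕ} (t : Fin n → ℝ) : 0 < polyGrowth t :=
  zero_lt_one.trans_le (one_le_polyGrowth t)

lemma one_add_abs_le_polyGrowth {n : ℕ} (t : Fin n → ℝ) (j : Fin n) :
    1 + |t j| ≤ polyGrowth t := by
  rw [polyGrowth, ← Finset.mul_prod_erase _ _ (Finset.mem_univ j)]
  have : ∏ _j ∈ Finset.univ.erase j, (1 : ℝ) ≤ ∏ i ∈ Finset.univ.erase j, (1 + |t i|) :=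
    Finset.prod_le_prod (fun _ _ => zero_le_one) fun j _ => by linarith [abs_nonneg (t j)]
  rw [Finset.prod_const_one] at this
  nlinarith [abs_nonneg (t j)]

lemma one_add_abs_sub_div_le {x y p q : ℝ} (hx : 1 + |x| ≤ p) (hy : 1 + |y| ≤ q) :
    1 + |(x - y) / 2| ≤ p * q := by
  have h := abs_sub x y
  rw [abs_div, abs_two]
  nlinarith [abs_nonneg x, abs_nonneg y, mul_nonneg (abs_nonneg x) (abs_nonneg y),
    mul_le_mul hx hy (by positivity) (by linarith [abs_nonneg x])]

lemma integrable_indicator_Ioc (a b : ℝ) : Integrable ((Set.Ioc a b).indicator (1 : ℝ → ℝ)) :=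
  (integrable_indicator_iff measurableSet_Ioc).2 
    (integrableOn_const (C := (1 : ℝ)) (by simp [Real.volume_Ioc]))

lemma integral_indicator_Ioc (a b : ℝ) :
    ∫ u, (Set.Ioc a b).indicator (1 : ℝ → ℝ) u = max (b - a) 0 := by
  rw [integral_indicator_one measurableSet_Ioc, Measure.real, Real.volume_Ioc,
    ENNReal.toReal_ofReal']

/-- The interlacing inequality: the cross distances between `n` and `n + 1` points dominate the
mutual distances, with linear gain when the `n` points leave the hull of the others. -/
lemma sum_max_abs_sub_le {n : ℕ} (t : Fin n → ℝ) (s : Fin (n + 1) → ℝ) (M : ℝ)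
    (hM : ∀ k, |s k| ≤ M) :
    ∑ j, max (|t j| - M) 0 ≤ ∑ j, ∑ k, |t j - s k| - spread t / 2 - spread s / 2 := by
  have hM0 : 0 ≤ M := (abs_nonneg _).trans (hM 0)
  -- Write `|a - b| = ∫ (H a u - H b u)² du`. If `X` of the `t_j` and `Y` of the `s_k` are at least
  -- `u`, the integrand on the right becomes `(X - Y)(X - Y + 1)`. For `u > M` one has `Y = 0`, and
  -- for `u ≤ -M` one has `Y = n + 1`; there the integrand also dominates the count of points
  -- outside the hull.
  let H : ℝ → ℝ → ℝ := fun x u => if u ≤ x then 1 else 0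
  have hH : ∀ a b, (fun u => (H a u - H b u) ^ 2)
      = (Set.Ioc (min a b) (max a b)).indicator (1 : ℝ → ℝ) := by
    intro a b
    ext u
    simp only [Set.indicator_apply, Set.mem_Ioc, Pi.one_apply, H, min_lt_iff, le_max_iff]
    by_cases h1 : u ≤ a <;> by_cases h2 : u ≤ b <;> simp [h1, h2]
  have hInt : ∀ a b, Integrable fun u => (H a u - H b u) ^ 2 := fun a b => by
    rw [hH]; exact integrable_indicator_Ioc _ _
  have hVal : ∀ a b, ∫ u, (H a u - H b u) ^ 2 = |a - b| := fun a b => by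
    rw [hH, integral_indicator_Ioc, max_sub_min_eq_abs', max_eq_left (abs_nonneg _)]
  have hA : ∀ j, Integrable fun u => (Set.Ioc M (t j)).indicator (1 : ℝ → ℝ) u +
      (Set.Ioc (t j) (-M)).indicator (1 : ℝ → ℝ) u := fun j =>
    (integrable_indicator_Ioc _ _).add (integrable_indicator_Ioc _ _)
  have hL : ∑ j, max (|t j| - M) 0 = ∫ u, ∑ j, ((Set.Ioc M (t j)).indicator (1 : ℝ → ℝ) u +
      (Set.Ioc (t j) (-M)).indicator (1 : ℝ → ℝ) u) := by
    rw [integral_finsetSum _ fun j _ => hA j]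
    refine Finset.sum_congr rfl fun j _ => ?_
    rw [integral_add (integrable_indicator_Ioc _ _) (integrable_indicator_Ioc _ _),
      integral_indicator_Ioc, integral_indicator_Ioc]
    rcases abs_cases (t j) with ⟨h, h'⟩ | ⟨h, h'⟩
    · rw [h, max_eq_right (a := -M - t j) (by linarith), add_zero]
    · rw [h, max_eq_right (a := t j - M) (by linarith), zero_add]
      ring_nf
  have hI2 : ∀ {p q : ℕ} (x : Fin p → ℝ) (y : Fin q → ℝ),
      Integrable fun u => ∑ a, ∑ b, (H (x a) u - H (y b) u) ^ 2 := fun x y =>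
    integrable_finsetSum _ fun a _ => integrable_finsetSum _ fun b _ => hInt _ _
  have hV2 : ∀ {p q : ℕ} (x : Fin p → ℝ) (y : Fin q → ℝ),
      ∫ u, ∑ a, ∑ b, (H (x a) u - H (y b) u) ^ 2 = ∑ a, ∑ b, |x a - y b| := fun x y => by
    rw [integral_finsetSum _ fun a _ => integrable_finsetSum _ fun b _ => hInt _ _]
    refine Finset.sum_congr rfl fun a _ => ?_
    rw [integral_finsetSum _ fun b _ => hInt _ _]
    exact Finset.sum_congr rfl fun b _ => hVal _ _
  have hR : ∑ j, ∑ k, |t j - s k| - spread t / 2 - spread s / 2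
      = ∫ u, (∑ j, ∑ k, (H (t j) u - H (s k) u) ^ 2 -
        (∑ a, ∑ b, (H (t a) u - H (t b) u) ^ 2) / 2 -
        (∑ a, ∑ b, (H (s a) u - H (s b) u) ^ 2) / 2) := by
    have hsub : Integrable fun u => ∑ j, ∑ k, (H (t j) u - H (s k) u) ^ 2 -
        (∑ a, ∑ b, (H (t a) u - H (t b) u) ^ 2) / 2 := (hI2 _ _).sub ((hI2 _ _).div_const _)
    rw [integral_sub hsub ((hI2 _ _).div_const _),
      integral_sub (hI2 _ _) ((hI2 _ _).div_const _), integral_div, integral_div, hV2, hV2, hV2]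
    rfl
  rw [hL, hR]
  refine integral_mono (integrable_finsetSum _ fun j _ => hA j)
    (((hI2 _ _).sub ((hI2 _ _).div_const _)).sub ((hI2 _ _).div_const _)) fun u => ?_
  have hsq : ∀ x, H x u ^ 2 = H x u := fun x => by
    simp only [H]; split_ifs <;> norm_num
  have hgen : ∀ {p q : ℕ} (x : Fin p → ℝ) (y : Fin q → ℝ),
      ∑ a, ∑ b, (H (x a) u - H (y b) u) ^ 2 =
        q * ∑ a, H (x a) u - 2 * (∑ a, H (x a) u) * (∑ b, H (y b) u) + p * ∑ b, H (y b) u := by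
    intro p q x y
    simp only [sub_sq, hsq, Finset.sum_add_distrib, Finset.sum_sub_distrib, Finset.sum_const,
      Finset.card_univ, Fintype.card_fin, nsmul_eq_mul, ← Finset.mul_sum, ← Finset.sum_mul]
  have hcard : ∀ {p : ℕ} (x : Fin p → ℝ),
      ∑ a, H (x a) u = ((Finset.univ.filter fun a => u ≤ x a).card : ℝ) := by
    intro p x
    simp [H]
  simp only [hgen]
  have hX0 : 0 ≤ ∑ j, H (t j) u := Finset.sum_nonneg fun j _ => by simp only [H]; split_ifs <;> norm_num
  push_cast
  rcases lt_or_ge M u with hu | hu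
  · have hY : ∑ k, H (s k) u = 0 := Finset.sum_eq_zero fun k _ => by
      simp [H, ((le_abs_self _).trans (hM k)).trans_lt hu]
    have hLu : ∑ j, ((Set.Ioc M (t j)).indicator (1 : ℝ → ℝ) u +
      (Set.Ioc (t j) (-M)).indicator (1 : ℝ → ℝ) u) = ∑ j, H (t j) u := by
      refine Finset.sum_congr rfl fun j _ => ?_
      have h2 : ¬ u ≤ -M := by linarith
      simp [Set.indicator_apply, H, hu, h2]
    rw [hLu, hY]
    nlinarith
  · rcases le_or_gt u (-M) with hu' | hu'
    · have hY : ∑ k, H (s k) u = n + 1 := by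
        have : ∀ k, H (s k) u = 1 := fun k => by
          simp [H, hu'.trans (neg_le_of_abs_le (hM k))]
        simp [this]
      have hLu : ∑ j, ((Set.Ioc M (t j)).indicator (1 : ℝ → ℝ) u +
        (Set.Ioc (t j) (-M)).indicator (1 : ℝ → ℝ) u) = n - ∑ j, H (t j) u := by
        have : ∀ j, ((Set.Ioc M (t j)).indicator (1 : ℝ → ℝ) u +
          (Set.Ioc (t j) (-M)).indicator (1 : ℝ → ℝ) u) = 1 - H (t j) u := fun j => by
          by_cases h : u ≤ t j
          · simp [H, hu', h, hu.not_gt]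
          · simp [H, hu', h, hu.not_gt, not_le.1 h]
        simp [this]
      rw [hLu, hY]
      nlinarith [sq_nonneg (n - ∑ j, H (t j) u)]
    · have hLu : ∑ j, ((Set.Ioc M (t j)).indicator (1 : ℝ → ℝ) u +
        (Set.Ioc (t j) (-M)).indicator (1 : ℝ → ℝ) u) = 0 := Finset.sum_eq_zero fun j _ => by
        simp [hu.not_gt, hu'.not_ge]
      rw [hLu, hcard, hcard]
      set X := (Finset.univ.filter fun a => u ≤ t a).card
      set Y := (Finset.univ.filter fun a => u ≤ s a).card
      -- Integrality is essential: `d (d + 1)` is negative for real `-1 < d < 0`.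
      have hint : (0 : ℤ) ≤ ((X : ℤ) - Y) * ((X : ℤ) - Y + 1) := by
        rcases le_or_gt (0 : ℤ) ((X : ℤ) - Y) with h | h
        · positivity
        · exact mul_nonneg_of_nonpos_of_nonpos h.le (by omega)
      have hreal : (0 : ℝ) ≤ ((X : ℝ) - Y) * ((X : ℝ) - Y + 1) := by exact_mod_cast hint
      nlinarith

lemma pow_mul_exp_neg_le (m : ℕ) {u : ℝ} (hu : 0 ≤ u) :
    (1 + u) ^ m * Real.exp (-(Real.pi / 2 * u)) ≤ m.factorial * Real.exp 1 := by
  have h := Real.pow_div_factorial_le_exp (1 + u) (by positivity) m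
  rw [div_le_iff₀ (by positivity)] at h
  have h2 : Real.exp (-(Real.pi / 2 * u)) ≤ Real.exp (-u) :=
    Real.exp_le_exp.2 (by nlinarith [Real.pi_gt_three])
  calc _ ≤ (Real.exp (1 + u) * m.factorial) * Real.exp (-u) := by gcongr
    _ = m.factorial * (Real.exp (1 + u) * Real.exp (-u)) := by ring
    _ = _ := by rw [← Real.exp_add]; simp

/-- If `u` is the excess of `|t|` over `M`, then `1 + |t| ≤ (1 + M)(1 + u)`, and powers of `1 + u`
are absorbed by the exponential. Two extra powers pay for the integrable factor. -/
lemma one_add_abs_pow_mul_exp_le (m : ℕ) (t : ℝ) {M : ℝ} (hM : 0 ≤ M) :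
    (1 + |t|) ^ m * Real.exp (-(Real.pi / 2 * max (|t| - M) 0)) ≤
      (m + 2).factorial * Real.exp 1 * (1 + M) ^ (m + 2) * (1 + t ^ 2)⁻¹ := by
  set u := max (|t| - M) 0 with hu
  have hu0 : 0 ≤ u := le_max_right _ _
  have hu1 : |t| - M ≤ u := le_max_left _ _
  have h1 : 1 + |t| ≤ (1 + M) * (1 + u) := by nlinarith [mul_nonneg hM hu0]
  have h2 : 1 + t ^ 2 ≤ (1 + |t|) ^ 2 := by nlinarith [abs_nonneg t, sq_abs t]
  rw [← div_eq_mul_inv, le_div_iff₀ (by positivity)]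
  calc _ ≤ (1 + |t|) ^ m * Real.exp (-(Real.pi / 2 * u)) * (1 + |t|) ^ 2 := by gcongr
    _ = (1 + |t|) ^ (m + 2) * Real.exp (-(Real.pi / 2 * u)) := by ring
    _ ≤ ((1 + M) * (1 + u)) ^ (m + 2) * Real.exp (-(Real.pi / 2 * u)) := by gcongr
    _ = (1 + M) ^ (m + 2) * ((1 + u) ^ (m + 2) * Real.exp (-(Real.pi / 2 * u))) := by
        rw [mul_pow, mul_assoc]
    _ ≤ (1 + M) ^ (m + 2) * ((m + 2).factorial * Real.exp 1) :=
        mul_le_mul_of_nonneg_left (pow_mul_exp_neg_le _ hu0) (by positivity)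
    _ = _ := by ring

/-- An integrable majorant. -/
noncomputable def cauchyDensity {n : ℕ} (t : Fin n → ℝ) : ℝ := ∏ j, (1 + t j ^ 2)⁻¹

lemma integrable_cauchyDensity {n : ℕ} : Integrable (cauchyDensity (n := n)) :=
  Integrable.fintype_prod (f := fun _ x => (1 + x ^ 2)⁻¹) fun _ => integrable_inv_one_add_sq

lemma cauchyDensity_add_le {n : ℕ} (T : ℝ) (t τ : Fin n → ℝ) (h : ∀ j, |τ j| ≤ T) :
    cauchyDensity (t + τ) ≤ (2 * (1 + T ^ 2)) ^ n * cauchyDensity t := by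
  have : cauchyDensity (t + τ) ≤ ∏ j : Fin n, (2 * (1 + T ^ 2) * (1 + t j ^ 2)⁻¹) := by
    refine Finset.prod_le_prod (fun _ _ => by positivity) fun j _ => ?_
    rw [← div_eq_mul_inv, le_div_iff₀ (by positivity), inv_mul_le_iff₀ (by positivity)]
    have h1 : τ j ^ 2 ≤ T ^ 2 := by
      rw [← sq_abs]; exact pow_le_pow_left₀ (abs_nonneg _) (h j) 2
    have : (t + τ) j = t j + τ j := rfl
    rw [this]
    nlinarith [sq_nonneg (t j + 2 * τ j), mul_nonneg (sq_nonneg T) (sq_nonneg (t j + τ j))]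
  refine this.trans_eq ?_
  rw [Finset.prod_mul_distrib]
  simp [cauchyDensity]

/-- Exponential decay governed by the interlacing inequality. -/
lemma growth_mul_exp_le {n : ℕ} (A : ℕ) :
    ∃ C : ℝ, ∃ A' : ℕ, 0 ≤ C ∧ ∀ (t : Fin n → ℝ) (s : Fin (n + 1) → ℝ),
      polyGrowth t ^ A * Real.exp (Real.pi / 4 * spread t - Real.pi / 2 * ∑ j, ∑ k, |t j - s k|) ≤
        C * polyGrowth s ^ A' * Real.exp (-(Real.pi / 4 * spread s)) * cauchyDensity t := by
  refine ⟨((A + 2).factorial * Real.exp 1) ^ n, (A + 2) * n, by positivity, fun t s => ?_⟩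
  -- Taking `M` to be the largest `|s k|` lets `polyGrowth s` absorb the powers of `1 + M`, one
  -- factor `(1 + M) ^ (A + 2)` per coordinate of `t`.
  obtain ⟨k, hk⟩ := Finite.exists_max fun k => |s k|
  have hD := sum_max_abs_sub_le t s |s k| hk
  have hexp : Real.exp (Real.pi / 4 * spread t - Real.pi / 2 * ∑ j, ∑ k, |t j - s k|) ≤
      Real.exp (-(Real.pi / 4 * spread s)) *
        ∏ j, Real.exp (-(Real.pi / 2 * max (|t j| - |s k|) 0)) := by
    rw [← Real.exp_sum, ← Real.exp_add, Real.exp_le_exp, Finset.sum_neg_distrib, ← Finset.mul_sum]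
    nlinarith [Real.pi_pos]
  have hprod : polyGrowth t ^ A * ∏ j, Real.exp (-(Real.pi / 2 * max (|t j| - |s k|) 0)) ≤
      ((A + 2).factorial * Real.exp 1) ^ n * polyGrowth s ^ ((A + 2) * n) * cauchyDensity t := by
    rw [polyGrowth, ← Finset.prod_pow, ← Finset.prod_mul_distrib]
    refine (Finset.prod_le_prod (fun _ _ => by positivity) fun j _ =>
      one_add_abs_pow_mul_exp_le A (t j) (abs_nonneg (s k))).trans ?_
    rw [Finset.prod_mul_distrib]
    simp only [Finset.prod_const, Finset.card_univ, Fintype.card_fin]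
    change _ * cauchyDensity t ≤ _
    have hc : 0 ≤ cauchyDensity t := Finset.prod_nonneg fun _ _ => by positivity
    refine mul_le_mul_of_nonneg_right ?_ hc
    rw [mul_pow, ← pow_mul]
    have := one_add_abs_le_polyGrowth s k
    gcongr
  calc _ ≤ polyGrowth t ^ A * (Real.exp (-(Real.pi / 4 * spread s)) *
        ∏ j, Real.exp (-(Real.pi / 2 * max (|t j| - |s k|) 0))) := by
        have := (polyGrowth_pos t).le
        gcongr
    _ = Real.exp (-(Real.pi / 4 * spread s)) * (polyGrowth t ^ A *
        ∏ j, Real.exp (-(Real.pi / 2 * max (|t j| - |s k|) 0))) := by ring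
    _ ≤ _ := by
        refine (mul_le_mul_of_nonneg_left hprod (Real.exp_pos _).le).trans_eq ?_
        ring

/-- The product of reciprocal Gamma functions with shifted arguments. -/
noncomputable def shiftedWeight {n : ℕ} (α β : Fin n → Fin n → ℝ) (nu : Fin n → ℂ) : ℂ :=
  ∏ a, ∏ b ∈ Finset.univ.erase a,
    (Complex.Gamma ((nu a - nu b) / 2 + α a b))⁻¹ * (Complex.Gamma ((nu a - nu b) / 2 + β a b))⁻¹

lemma sklyaninWeight_eq {n : ℕ} (g : ℝ) (nu : Fin n → ℂ) :
    sklyaninWeight g nu = shiftedWeight (fun _ _ => 0) (fun _ _ => g) nu := by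
  refine Finset.prod_congr rfl fun a _ => Finset.prod_congr rfl fun b _ => ?_
  rw [Complex.ofReal_zero, add_zero]
  congr 3
  ring

/-- The arguments contain half differences, so each reciprocal Gamma grows at rate `π/4`; two of
them for each ordered pair give `π/2`. -/
lemma exists_norm_shiftedWeight_le {n : ℕ} (α β : Fin n → Fin n → ℝ) (R : ℝ) :
    ∃ C : ℝ, ∃ A : ℕ, 0 ≤ C ∧ ∀ nu : Fin n → ℂ, (∀ a b, |(nu a - nu b).re| ≤ R) →
      ‖shiftedWeight α β nu‖ ≤ C * polyGrowth (fun j => (nu j).im) ^ A *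
        Real.exp (Real.pi / 2 * spread fun j => (nu j).im) := by
  obtain ⟨C, A, hC, h⟩ := exists_norm_inv_Gamma_le
    (R / 2 + ∑ a, ∑ b, |α a b| + ∑ a, ∑ b, |β a b|)
  refine ⟨∏ _a : Fin n, ∏ _b ∈ Finset.univ.erase _a, C ^ 2,
    ∑ a : Fin n, ∑ _b ∈ Finset.univ.erase a, 4 * A, by positivity, fun nu hnu => ?_⟩
  set t : Fin n → ℝ := fun j => (nu j).im with ht
  have hone : ∀ (γ : Fin n → Fin n → ℝ) (a b : Fin n),
      |γ a b| ≤ ∑ a, ∑ b, |α a b| + ∑ a, ∑ b, |β a b| →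
      ‖(Complex.Gamma ((nu a - nu b) / 2 + γ a b))⁻¹‖ ≤
        C * polyGrowth t ^ (2 * A) * Real.exp (Real.pi / 4 * |t a - t b|) := by
    intro γ a b hγ
    have hre : ((nu a - nu b) / 2 + (γ a b : ℂ)).re = (nu a - nu b).re / 2 + γ a b := by simp
    have him : ((nu a - nu b) / 2 + (γ a b : ℂ)).im = (t a - t b) / 2 := by simp [ht]
    refine (h _ ?_).trans ?_
    · rw [hre]
      refine (abs_add_le _ _).trans ?_
      rw [abs_div, abs_two]
      linarith [hnu a b]
    · rw [him, pow_mul, show Real.pi / 2 * |(t a - t b) / 2| = Real.pi / 4 * |t a - t b| by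
        rw [abs_div, abs_two]; ring]
      have := one_add_abs_sub_div_le (one_add_abs_le_polyGrowth t a) (one_add_abs_le_polyGrowth t b)
      rw [← sq] at this
      gcongr
  have hle : ∀ (γ : Fin n → Fin n → ℝ) a b, |γ a b| ≤ ∑ a, ∑ b, |γ a b| := fun γ a b =>
    (Finset.single_le_sum (f := fun b => |γ a b|) (fun _ _ => abs_nonneg _)
      (Finset.mem_univ b)).trans (Finset.single_le_sum (f := fun a => ∑ b, |γ a b|)
      (fun _ _ => Finset.sum_nonneg fun _ _ => abs_nonneg _) (Finset.mem_univ a))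
  have hnn : ∀ (γ : Fin n → Fin n → ℝ), 0 ≤ ∑ a, ∑ b, |γ a b| := fun γ =>
    Finset.sum_nonneg fun _ _ => Finset.sum_nonneg fun _ _ => abs_nonneg _
  have hspread : ∑ a, ∑ b ∈ Finset.univ.erase a, |t a - t b| = spread t :=
    Finset.sum_congr rfl fun a _ => Finset.sum_erase _ (by simp)
  rw [shiftedWeight, norm_prod]
  calc ∏ a, ‖∏ b ∈ Finset.univ.erase a, _‖
      ≤ ∏ a, ∏ b ∈ Finset.univ.erase a,
        (C ^ 2 * polyGrowth t ^ (4 * A) * Real.exp (Real.pi / 2 * |t a - t b|)) := by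
        refine Finset.prod_le_prod (fun _ _ => norm_nonneg _) fun a _ => ?_
        rw [norm_prod]
        refine Finset.prod_le_prod (fun _ _ => norm_nonneg _) fun b _ => ?_
        rw [norm_mul]
        have h1 := hone α a b (by linarith [hle α a b, hnn β])
        have h2 := hone β a b (by linarith [hle β a b, hnn α])
        refine (mul_le_mul h1 h2 (norm_nonneg _) ((norm_nonneg _).trans h1)).trans_eq ?_
        rw [show Real.pi / 2 * |t a - t b| = Real.pi / 4 * |t a - t b| + Real.pi / 4 * |t a - t b|
          by ring, Real.exp_add]
        ring
    _ = _ := by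
        simp only [Finset.prod_mul_distrib, ← Real.exp_sum, Finset.prod_pow_eq_pow_sum,
          ← Finset.mul_sum, hspread]

/-- Every Gamma argument has real part at least `(g - ρ) / 2 > 0`, hence stays away from the poles.
The two factors of a pair decay at rate `π/4` each. -/
lemma exists_norm_gammaKernel_le (n : ℕ) {g ρ : ℝ} (hρ : ρ < g) :
    ∃ C : ℝ, ∃ A : ℕ, 0 ≤ C ∧ ∀ (lam : Fin (n + 1) → ℂ) (nu : Fin n → ℂ),
      (∀ j k, |(lam k - nu j).re| ≤ ρ) →
      ‖gammaKernel g lam nu‖ ≤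
        C * (polyGrowth (fun j => (nu j).im) * polyGrowth (fun k => (lam k).im)) ^ A *
          Real.exp (-(Real.pi / 2 * ∑ j, ∑ k, |(nu j).im - (lam k).im|)) := by
  obtain ⟨C, A, hC, h⟩ := exists_norm_Gamma_le ((g - ρ) / 2) ((g + ρ) / 2) (by linarith)
  refine ⟨∏ _j : Fin n, ∏ _k : Fin (n + 1), C ^ 2, ∑ _j : Fin n, ∑ _k : Fin (n + 1), 2 * A,
    by positivity, fun lam nu hre => ?_⟩
  set t : Fin n → ℝ := fun j => (nu j).im with ht
  set s : Fin (n + 1) → ℝ := fun j => (lam j).im with hs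
  rw [gammaKernel, norm_prod]
  calc ∏ j, ‖∏ k, _‖
      ≤ ∏ j, ∏ k, (C ^ 2 * (polyGrowth t * polyGrowth s) ^ (2 * A) *
          Real.exp (-(Real.pi / 2 * |t j - s k|))) := by
        refine Finset.prod_le_prod (fun _ _ => norm_nonneg _) fun j _ => ?_
        rw [norm_prod]
        refine Finset.prod_le_prod (fun _ _ => norm_nonneg _) fun k _ => ?_
        obtain ⟨h1, h2⟩ := abs_le.1 (hre j k)
        simp only [Complex.sub_re] at h1 h2
        have e1 := h ((nu j - lam k + g) / 2) (by simp; linarith) (by simp; linarith)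
        have e2 := h ((lam k - nu j + g) / 2) (by simp; linarith) (by simp; linarith)
        have i1 : ((nu j - lam k + g) / 2).im = (t j - s k) / 2 := by simp [ht, hs]
        have i2 : ((lam k - nu j + g) / 2).im = -((t j - s k) / 2) := by simp [ht, hs]; ring
        rw [i1] at e1
        rw [i2, abs_neg] at e2
        rw [norm_mul]
        refine (mul_le_mul e1 e2 (norm_nonneg _) ((norm_nonneg _).trans e1)).trans ?_
        have hp := one_add_abs_sub_div_le (one_add_abs_le_polyGrowth t j)
          (one_add_abs_le_polyGrowth s k)
        have hx : Real.exp (-(Real.pi / 2 * |t j - s k|)) =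
            Real.exp (-(Real.pi / 2 * |(t j - s k) / 2|)) *
              Real.exp (-(Real.pi / 2 * |(t j - s k) / 2|)) := by
          rw [← Real.exp_add, abs_div, abs_two]; congr 1; ring
        calc _ = C ^ 2 * (1 + |(t j - s k) / 2|) ^ (2 * A) *
              (Real.exp (-(Real.pi / 2 * |(t j - s k) / 2|)) *
              Real.exp (-(Real.pi / 2 * |(t j - s k) / 2|))) := by ring
          _ ≤ _ := by rw [← hx]; gcongr
    _ = _ := by
        simp only [Finset.prod_mul_distrib, ← Real.exp_sum, Finset.prod_pow_eq_pow_sum,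
          ← Finset.mul_sum, Finset.sum_neg_distrib]
        rfl

/-- The integrand of a Barnes type integral with a general weight, without its last factor. -/
noncomputable def weightedIntegrand (g : ℝ) {n : ℕ} (α β : Fin n → Fin n → ℝ) (y : ℝ)
    (lam : Fin (n + 1) → ℂ) (nu : Fin n → ℂ) : ℂ :=
  shiftedWeight α β nu * gammaKernel g lam nu *
    Complex.exp ((∑ k, lam k - ∑ j, nu j) * (y : ℂ))

/-- The pointwise bound giving absolute convergence, uniformly for real parts in compact sets. -/
lemma exists_norm_weightedIntegrand_mul_le {n : ℕ} {g ρ : ℝ} (hρ : ρ < g)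
    (α β : Fin n → Fin n → ℝ) (y R C₀ : ℝ) (A₀ : ℕ) (hC₀ : 0 ≤ C₀) :
    ∃ C : ℝ, ∃ A : ℕ, 0 ≤ C ∧ ∀ (lam : Fin (n + 1) → ℂ) (nu : Fin n → ℂ) (w : ℂ),
      (∀ j k, |(lam k - nu j).re| ≤ ρ) → (∀ k, |(lam k).re| ≤ R) → (∀ j, |(nu j).re| ≤ R) →
      ‖w‖ ≤ C₀ * polyGrowth (fun j => (nu j).im) ^ A₀ *
        Real.exp (-(Real.pi / 4 * spread fun j => (nu j).im)) →
      ‖weightedIntegrand g α β y lam nu * w‖ ≤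
        C * polyGrowth (fun k => (lam k).im) ^ A *
          Real.exp (-(Real.pi / 4 * spread fun k => (lam k).im)) *
          cauchyDensity (fun j => (nu j).im) := by
  obtain ⟨C₁, A₁, hC₁, h₁⟩ := exists_norm_shiftedWeight_le α β (R + R)
  obtain ⟨C₂, A₂, hC₂, h₂⟩ := exists_norm_gammaKernel_le n hρ
  -- Balance of exponents: `π/2` from the weight minus `π/4` from `w` leaves `π/4 * spread t`.
  -- Interlacing trades this and the kernel decay for `-π/4 * spread s`, the same form of decay in
  -- the outer variables.
  obtain ⟨C₃, A₃, hC₃, h₃⟩ := growth_mul_exp_le (n := n) (A₁ + A₂ + A₀)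
  set E := Real.exp (((n + 1) * R + n * R) * |y|) with hE
  refine ⟨C₁ * C₂ * C₀ * E * C₃, A₂ + A₃, by positivity, fun lam nu w hre hl hn hw => ?_⟩
  set t : Fin n → ℝ := fun j => (nu j).im with ht
  set s : Fin (n + 1) → ℝ := fun j => (lam j).im with hs
  have b1 := h₁ nu fun a b => by
    rw [Complex.sub_re]; exact (abs_sub _ _).trans (add_le_add (hn a) (hn b))
  have b2 := h₂ lam nu hre
  have b4 : ‖Complex.exp ((∑ k, lam k - ∑ j, nu j) * (y : ℂ))‖ ≤ E := by
    rw [Complex.norm_exp, hE, Real.exp_le_exp, Complex.re_mul_ofReal]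
    refine (le_abs_self _).trans ?_
    rw [abs_mul]
    refine mul_le_mul_of_nonneg_right ?_ (abs_nonneg _)
    rw [Complex.sub_re, Complex.re_sum, Complex.re_sum]
    refine (abs_sub _ _).trans (add_le_add ?_ ?_)
    · refine (Finset.abs_sum_le_sum_abs _ _).trans ?_
      refine (Finset.sum_le_sum fun k _ => hl k).trans_eq ?_
      simp
    · refine (Finset.abs_sum_le_sum_abs _ _).trans ?_
      refine (Finset.sum_le_sum fun k _ => hn k).trans_eq ?_
      simp
  have b3 := h₃ t s
  have hpt := (polyGrowth_pos t).le
  have hps := (polyGrowth_pos s).le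
  rw [weightedIntegrand, norm_mul, norm_mul, norm_mul]
  calc _ ≤ (C₁ * polyGrowth t ^ A₁ * Real.exp (Real.pi / 2 * spread t)) *
        (C₂ * (polyGrowth t * polyGrowth s) ^ A₂ *
          Real.exp (-(Real.pi / 2 * ∑ j, ∑ k, |t j - s k|))) * E *
        (C₀ * polyGrowth t ^ A₀ * Real.exp (-(Real.pi / 4 * spread t))) := by
        gcongr
    _ = (C₁ * C₂ * C₀ * E) * polyGrowth s ^ A₂ * (polyGrowth t ^ (A₁ + A₂ + A₀) *
        (Real.exp (Real.pi / 2 * spread t) *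
          Real.exp (-(Real.pi / 2 * ∑ j, ∑ k, |t j - s k|)) *
          Real.exp (-(Real.pi / 4 * spread t)))) := by ring
    _ = (C₁ * C₂ * C₀ * E) * polyGrowth s ^ A₂ * (polyGrowth t ^ (A₁ + A₂ + A₀) *
        Real.exp (Real.pi / 4 * spread t - Real.pi / 2 * ∑ j, ∑ k, |t j - s k|)) := by
        rw [← Real.exp_add, ← Real.exp_add]
        ring_nf
    _ ≤ (C₁ * C₂ * C₀ * E) * polyGrowth s ^ A₂ * (C₃ * polyGrowth s ^ A₃ *
        Real.exp (-(Real.pi / 4 * spread s)) * cauchyDensity t) := by gcongr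
    _ = _ := by ring

-- Holomorphic dependence of integrals on parameters

/-- Cauchy's estimate for the Fréchet derivative of a bounded holomorphic function. -/
lemma norm_fderiv_le_of_bounded {E : Type*} [NormedAddCommGroup E] [NormedSpace ℂ E] {f : E → ℂ}
    {w : E} {r C : ℝ} (hr : 0 < r) (hf : DifferentiableOn ℂ f (Metric.ball w r))
    (hC : ∀ u ∈ Metric.ball w r, ‖f u‖ ≤ C) : ‖fderiv ℂ f w‖ ≤ C / (r / 2) := by
  have hC0 : 0 ≤ C := (norm_nonneg _).trans (hC w (Metric.mem_ball_self hr))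
  refine ContinuousLinearMap.opNorm_le_bound _ (by positivity) fun v => ?_
  rcases eq_or_ne v 0 with rfl | hv
  · simp
  have hv' : 0 < ‖v‖ := norm_pos_iff.2 hv
  -- The radius for which `z ↦ w + z • v` stays within distance `r / 2` of `w`; the one-variable
  -- Cauchy estimate is applied along this line.
  set ρ := r / 2 / ‖v‖ with hρ
  have hρ0 : 0 < ρ := by positivity
  have hmem : ∀ z ∈ Metric.closedBall (0 : ℂ) ρ, w + z • v ∈ Metric.ball w r := by
    intro z hz
    rw [mem_closedBall_zero_iff] at hz
    rw [mem_ball_iff_norm, add_sub_cancel_left, norm_smul]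
    calc ‖z‖ * ‖v‖ ≤ ρ * ‖v‖ := by gcongr
      _ = r / 2 := by rw [hρ]; field_simp
      _ < r := by linarith
  have hd : DifferentiableOn ℂ (fun z : ℂ => f (w + z • v)) (Metric.closedBall 0 ρ) :=
    hf.comp (by fun_prop) hmem
  have h0 : HasDerivAt (fun z : ℂ => f (w + z • v)) (fderiv ℂ f w v) 0 := by
    have h1 : HasFDerivAt f (fderiv ℂ f w) (w + (0 : ℂ) • v) := by
      rw [zero_smul, add_zero]
      exact (hf.differentiableAt (Metric.ball_mem_nhds w hr)).hasFDerivAt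
    have h2 : HasDerivAt (fun z : ℂ => w + z • v) v 0 := by
      simpa using ((hasDerivAt_id (0 : ℂ)).smul_const v).const_add w
    exact h1.comp_hasDerivAt 0 h2
  have hdc : DiffContOnCl ℂ (fun z : ℂ => f (w + z • v)) (Metric.ball 0 ρ) :=
    (hd.mono Metric.closure_ball_subset_closedBall).diffContOnCl
  have := Complex.norm_deriv_le_of_forall_mem_sphere_norm_le hρ0 hdc
    (fun z hz => hC _ (hmem z (Metric.sphere_subset_closedBall hz)))
  rw [h0.deriv] at this
  refine this.trans_eq ?_
  rw [hρ]; field_simp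

/-- Coordinate derivatives are pointwise limits of difference quotients along a sequence of steps
below `ε`, and finitely many of them determine the Fréchet derivative. -/
lemma aestronglyMeasurable_fderiv_param {ι α : Type*} [Fintype ι] [MeasurableSpace α]
    {μ : Measure α} {f : (ι → ℂ) → α → ℂ} {w : ι → ℂ} {ε : ℝ} (hε : 0 < ε)
    (hmeas : ∀ u ∈ Metric.ball w ε, AEStronglyMeasurable (f u) μ)
    (hdiff : ∀ a, DifferentiableOn ℂ (fun u => f u a) (Metric.ball w ε)) :
    AEStronglyMeasurable (fun a => fderiv ℂ (fun u => f u a) w) μ := by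
  classical
  have hcoord : ∀ i, AEStronglyMeasurable
      (fun a => fderiv ℂ (fun u => f u a) w (Pi.single i 1)) μ := by
    intro i
    set τ : ℕ → ℂ := fun N => ((ε / 2 * (1 / ((N : ℝ) + 1)) : ℝ) : ℂ) with hτ
    have hτpos : ∀ N : ℕ, 0 < ε / 2 * (1 / ((N : ℝ) + 1)) := fun N => by positivity
    have hτ0 : Filter.Tendsto τ Filter.atTop (nhdsWithin 0 {0}ᶜ) := by
      refine tendsto_nhdsWithin_iff.2 ⟨?_, Filter.Eventually.of_forall fun N => ?_⟩
      · have := (tendsto_one_div_add_atTop_nhds_zero_nat (𝕜 := ℝ)).const_mul (ε / 2)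
        rw [mul_zero] at this
        have h2 := (Complex.continuous_ofReal.tendsto 0).comp this
        rwa [Complex.ofReal_zero] at h2
      · exact Complex.ofReal_ne_zero.2 (hτpos N).ne'
    have hmem : ∀ N, w + τ N • (Pi.single i 1 : ι → ℂ) ∈ Metric.ball w ε := by
      intro N
      rw [mem_ball_iff_norm, add_sub_cancel_left, norm_smul, Pi.norm_single, norm_one, mul_one, hτ,
        Complex.norm_real, Real.norm_of_nonneg (hτpos N).le]
      have : 1 / ((N : ℝ) + 1) ≤ 1 := by
        rw [div_le_one (by positivity)]; linarith [Nat.cast_nonneg (α := ℝ) N]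
      nlinarith
    refine aestronglyMeasurable_of_tendsto_ae Filter.atTop
      (f := fun N a => (τ N)⁻¹ • (f (w + τ N • (Pi.single i 1 : ι → ℂ)) a - f w a))
      (fun N => (((hmeas _ (hmem N)).sub (hmeas _ (Metric.mem_ball_self hε))).const_smul (τ N)⁻¹ :))
      (Filter.Eventually.of_forall fun a => ?_)
    have h0 : HasDerivAt (fun z : ℂ => f (w + z • (Pi.single i 1 : ι → ℂ)) a)
        (fderiv ℂ (fun u => f u a) w (Pi.single i 1)) 0 := by
      have h1 : HasFDerivAt (fun u => f u a) (fderiv ℂ (fun u => f u a) w)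
          (w + (0 : ℂ) • (Pi.single i 1 : ι → ℂ)) := by
        rw [zero_smul, add_zero]
        exact ((hdiff a).differentiableAt (Metric.ball_mem_nhds w hε)).hasFDerivAt
      have h2 : HasDerivAt (fun z : ℂ => w + z • (Pi.single i 1 : ι → ℂ)) (Pi.single i 1) 0 := by
        simpa using ((hasDerivAt_id (0 : ℂ)).smul_const (Pi.single i 1 : ι → ℂ)).const_add w
      exact h1.comp_hasDerivAt 0 h2
    have := (h0.tendsto_slope_zero).comp hτ0
    simpa [Function.comp_def] using this
  have heq : (fun a => fderiv ℂ (fun u => f u a) w) = fun a => ∑ i,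
      (fderiv ℂ (fun u => f u a) w (Pi.single i 1)) •
        (ContinuousLinearMap.proj (R := ℂ) (φ := fun _ : ι => ℂ) i) := by
    ext a v
    conv_lhs => rw [pi_eq_sum_univ' v, map_sum]
    simp [mul_comm]
  rw [heq]
  exact Finset.aestronglyMeasurable_fun_sum _ fun i _ => (hcoord i).smul_const _

/-- A locally dominated integral of holomorphic functions is holomorphic. -/
lemma differentiableAt_integral_of_dominated {ι α : Type*} [Fintype ι] [MeasurableSpace α]
    {μ : Measure α} {f : (ι → ℂ) → α → ℂ} {w : ι → ℂ} {ε : ℝ} (hε : 0 < ε) {bound : α → ℝ}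
    (hmeas : ∀ u ∈ Metric.ball w ε, AEStronglyMeasurable (f u) μ)
    (hdiff : ∀ a, DifferentiableOn ℂ (fun u => f u a) (Metric.ball w ε))
    (hbound : ∀ u ∈ Metric.ball w ε, ∀ a, ‖f u a‖ ≤ bound a) (hint : Integrable bound μ) :
    DifferentiableAt ℂ (fun u => ∫ a, f u a ∂μ) w := by
  have hsub : ∀ u ∈ Metric.ball w (ε / 2), Metric.ball u (ε / 2) ⊆ Metric.ball w ε := by
    intro u hu
    refine Metric.ball_subset_ball' ?_
    have := Metric.mem_ball.1 hu
    linarith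
  have hw := Metric.mem_ball_self (x := w) hε
  have hself : ∀ u ∈ Metric.ball w (ε / 2), u ∈ Metric.ball w ε := fun u hu =>
    hsub u hu (Metric.mem_ball_self (half_pos hε))
  refine (hasFDerivAt_integral_of_dominated_of_fderiv_le (F := f)
    (F' := fun u a => fderiv ℂ (fun u => f u a) u) (bound := fun a => bound a / (ε / 2 / 2))
    (Metric.ball_mem_nhds w (half_pos hε)) ?_ ?_ ?_ ?_ ?_ ?_).differentiableAt
  · filter_upwards [Metric.ball_mem_nhds w hε] with u hu using hmeas u hu
  · exact hint.mono' (hmeas w hw) (Filter.Eventually.of_forall (hbound w hw))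
  · exact aestronglyMeasurable_fderiv_param hε hmeas hdiff
  · exact Filter.Eventually.of_forall fun a u hu =>
      norm_fderiv_le_of_bounded (half_pos hε) ((hdiff a).mono (hsub u hu))
        fun v hv => hbound v (hsub u hu hv) a
  · exact hint.div_const _
  · exact Filter.Eventually.of_forall fun a u hu =>
      ((hdiff a).differentiableAt (Metric.isOpen_ball.mem_nhds (hself u hu))).hasFDerivAt

/-- A holomorphic function on a convex open set which is invariant under imaginary translations is
constant. -/
lemma eq_of_imaginary_invariant {h : ℂ → ℂ} {U : Set ℂ} (hU : IsOpen U) (hc : Convex ℝ U)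
    (hd : DifferentiableOn ℂ h U)
    (hinv : ∀ z ∈ U, ∀ s : ℝ, h (z + s * Complex.I) = h z) {z₁ z₂ : ℂ} (h₁ : z₁ ∈ U)
    (h₂ : z₂ ∈ U) : h z₁ = h z₂ := by
  have hder : ∀ z ∈ U, deriv h z = 0 := by
    intro z hz
    have hz' := (hd.differentiableAt (hU.mem_nhds hz)).hasDerivAt
    -- For a holomorphic function, a vanishing derivative in the imaginary direction forces the
    -- complex derivative to vanish.
    have h1 : HasDerivAt (fun s : ℝ => h (z + s * Complex.I)) (deriv h z * Complex.I) 0 := by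
      have hin : HasDerivAt (fun s : ℝ => z + s * Complex.I) Complex.I 0 := by
        simpa using ((Complex.ofRealCLM.hasDerivAt (x := 0)).mul_const Complex.I).const_add z
      have : HasDerivAt h (deriv h z) (z + ((0 : ℝ) : ℂ) * Complex.I) := by simpa using hz'
      exact this.comp (0 : ℝ) hin
    have h2 : HasDerivAt (fun s : ℝ => h (z + s * Complex.I)) 0 0 := by
      simp only [hinv z hz]
      exact hasDerivAt_const _ _
    simpa using h1.unique h2
  refine hc.is_const_of_fderivWithin_eq_zero (𝕜 := ℂ) hd (fun z hz => ?_) h₁ h₂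
  rw [fderivWithin_of_isOpen hU hz]
  ext
  simp [hder z hz]

-- Holomorphy and translation covariance of the integrand

lemma differentiableAt_finset_prod {E ι : Type*} [NormedAddCommGroup E] [NormedSpace ℂ E]
    {s : Finset ι} {f : ι → E → ℂ} {x : E} (h : ∀ i ∈ s, DifferentiableAt ℂ (f i) x) :
    DifferentiableAt ℂ (fun x => ∏ i ∈ s, f i x) x := by
  classical
  exact (HasFDerivAt.finsetProd fun i hi => (h i hi).hasFDerivAt).differentiableAt

/-- As `1 / Γ` is entire, the weight never obstructs a contour shift; only the kernel restricts the
contours. -/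
lemma differentiable_shiftedWeight {n : ℕ} (α β : Fin n → Fin n → ℝ) :
    Differentiable ℂ (shiftedWeight α β) := by
  have hone : ∀ (γ : ℝ) (a b : Fin n), Differentiable ℂ fun nu : Fin n → ℂ =>
      (Complex.Gamma ((nu a - nu b) / 2 + γ))⁻¹ := fun γ a b =>
    Complex.differentiable_one_div_Gamma.comp
      (f := fun nu : Fin n → ℂ => (nu a - nu b) / 2 + γ) (by fun_prop)
  unfold shiftedWeight
  exact fun nu => differentiableAt_finset_prod fun a _ => differentiableAt_finset_prod fun b _ =>
    (hone (α a b) a b nu).fun_mul (hone (β a b) a b nu)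

lemma differentiableAt_Gamma_of_re_pos {z : ℂ} (hz : 0 < z.re) :
    DifferentiableAt ℂ Complex.Gamma z :=
  Complex.differentiableAt_Gamma _ fun m h => by
    have := congrArg Complex.re h
    simp at this
    linarith [Nat.cast_nonneg (α := ℝ) m]

lemma differentiableAt_weightedIntegrand {n : ℕ} {g : ℝ} (α β : Fin n → Fin n → ℝ) (y : ℝ)
    (p : (Fin (n + 1) → ℂ) × (Fin n → ℂ)) (hp : ∀ j k, |(p.1 k - p.2 j).re| < g) :
    DifferentiableAt ℂ (fun p : (Fin (n + 1) → ℂ) × (Fin n → ℂ) =>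
      weightedIntegrand g α β y p.1 p.2) p := by
  unfold weightedIntegrand gammaKernel
  have hW : DifferentiableAt ℂ
      (fun p : (Fin (n + 1) → ℂ) × (Fin n → ℂ) => shiftedWeight α β p.2) p :=
    (differentiable_shiftedWeight α β).differentiableAt.comp p differentiableAt_snd
  have h1 : ∀ (j : Fin n) (k : Fin (n + 1)), DifferentiableAt ℂ
      (fun p : (Fin (n + 1) → ℂ) × (Fin n → ℂ) => Complex.Gamma ((p.2 j - p.1 k + g) / 2)) p := by
    intro j k
    refine DifferentiableAt.comp p (g := Complex.Gamma)
      (f := fun p : (Fin (n + 1) → ℂ) × (Fin n → ℂ) => (p.2 j - p.1 k + g) / 2) ?_ (by fun_prop)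
    refine differentiableAt_Gamma_of_re_pos ?_
    have := abs_lt.1 (hp j k)
    simp at this ⊢
    linarith
  have h2 : ∀ (j : Fin n) (k : Fin (n + 1)), DifferentiableAt ℂ
      (fun p : (Fin (n + 1) → ℂ) × (Fin n → ℂ) => Complex.Gamma ((p.1 k - p.2 j + g) / 2)) p := by
    intro j k
    refine DifferentiableAt.comp p (g := Complex.Gamma)
      (f := fun p : (Fin (n + 1) → ℂ) × (Fin n → ℂ) => (p.1 k - p.2 j + g) / 2) ?_ (by fun_prop)
    refine differentiableAt_Gamma_of_re_pos ?_
    have := abs_lt.1 (hp j k)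
    simp at this ⊢
    linarith
  have hK : DifferentiableAt ℂ (fun p : (Fin (n + 1) → ℂ) × (Fin n → ℂ) =>
      ∏ j, ∏ k, Complex.Gamma ((p.2 j - p.1 k + g) / 2) *
        Complex.Gamma ((p.1 k - p.2 j + g) / 2)) p :=
    differentiableAt_finset_prod fun j _ => differentiableAt_finset_prod fun k _ =>
      (h1 j k).fun_mul (h2 j k)
  exact (hW.fun_mul hK).fun_mul (by fun_prop)

lemma shiftedWeight_add_const {n : ℕ} (α β : Fin n → Fin n → ℝ) (nu : Fin n → ℂ) (c : ℂ) :
    shiftedWeight α β (fun j => nu j + c) = shiftedWeight α β nu := by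
  simp only [shiftedWeight, add_sub_add_right_eq_sub]

lemma gammaKernel_add_const {n : ℕ} (g : ℝ) (lam : Fin (n + 1) → ℂ) (nu : Fin n → ℂ) (c : ℂ) :
    gammaKernel g (fun k => lam k + c) (fun j => nu j + c) = gammaKernel g lam nu := by
  simp only [gammaKernel, add_sub_add_right_eq_sub]

lemma weightedIntegrand_add_const {n : ℕ} (g : ℝ) (α β : Fin n → Fin n → ℝ) (y : ℝ)
    (lam : Fin (n + 1) → ℂ) (nu : Fin n → ℂ) (c : ℂ) :
    weightedIntegrand g α β y (fun k => lam k + c) (fun j => nu j + c) =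
      Complex.exp (c * y) * weightedIntegrand g α β y lam nu := by
  have : (∑ k, (lam k + c) - ∑ j, (nu j + c)) * (y : ℂ)
      = c * y + (∑ k, lam k - ∑ j, nu j) * y := by
    simp only [Finset.sum_add_distrib, Finset.sum_const, Finset.card_univ, Fintype.card_fin,
      nsmul_eq_mul]
    push_cast
    ring
  rw [weightedIntegrand, weightedIntegrand, shiftedWeight_add_const, gammaKernel_add_const, this,
    Complex.exp_add]
  ring

lemma barnesIntegrand_eq {n : ℕ} (g : ℝ) (lam : Fin (n + 1) → ℂ) (y : ℝ) (f : (Fin n → ℂ) → ℂ)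
    (t : Fin n → ℝ) :
    barnesIntegrand g lam y f t =
      weightedIntegrand g (fun _ _ => 0) (fun _ _ => g) y lam (fun j => Complex.I * t j) *
        f (fun j => Complex.I * t j) := by
  rw [weightedIntegrand, ← sklyaninWeight_eq]
  rfl

lemma exists_lt_forall_le {ι : Type*} [Finite ι] {a : ι → ℝ} {b : ℝ} (h : ∀ i, a i < b) :
    ∃ ρ, ρ < b ∧ ∀ i, a i ≤ ρ := by
  have h1 : ∀ᶠ ρ in nhdsWithin b (Set.Iio b), ∀ i, a i ≤ ρ :=
    Filter.eventually_all.2 fun i =>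
      (Filter.mem_of_superset (Ioo_mem_nhdsLT (h i)) fun _ hx => hx.1.le)
  obtain ⟨ρ, h2, h3⟩ := (h1.and self_mem_nhdsWithin).exists
  exact ⟨ρ, h3, h2⟩

lemma spread_nonneg {n : ℕ} (t : Fin n → ℝ) : 0 ≤ spread t :=
  Finset.sum_nonneg fun _ _ => Finset.sum_nonneg fun _ _ => abs_nonneg _

lemma cauchyDensity_nonneg {n : ℕ} (t : Fin n → ℝ) : 0 ≤ cauchyDensity t :=
  Finset.prod_nonneg fun _ _ => by positivity

-- Decay and holomorphy of the iterated integral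

/-- The bound `C ∏ (1 + |Im ν_j|) ^ A exp (-π/4 ∑ |Im (ν_a - ν_b)|)` on a set. -/
def HasSpectralDecay {n : ℕ} (f : (Fin n → ℂ) → ℂ) (S : Set (Fin n → ℂ)) : Prop :=
  ∃ C : ℝ, ∃ A : ℕ, 0 ≤ C ∧ ∀ nu ∈ S, ‖f nu‖ ≤ C * polyGrowth (fun j => (nu j).im) ^ A *
    Real.exp (-(Real.pi / 4 * spread fun j => (nu j).im))

/-- The polystrip `|Re ν_j| < g`. -/
def polystrip (g : ℝ) (n : ℕ) : Set (Fin n → ℂ) := {nu | ∀ j, |(nu j).re| < g}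

lemma isOpen_polystrip (g : ℝ) (n : ℕ) : IsOpen (polystrip g n) := by
  simp only [polystrip, Set.ofPred_forall]
  exact isOpen_iInter_of_finite fun j => isOpen_lt (by fun_prop) continuous_const

lemma imaginary_mem_polystrip {g : ℝ} (hg : 0 < g) {n : ℕ} (t : Fin n → ℝ) :
    (fun j => Complex.I * t j) ∈ polystrip g n := fun j => by simpa using hg

section barnes

variable {n : ℕ} {g : ℝ} {f : (Fin n → ℂ) → ℂ} (α β : Fin n → Fin n → ℝ) (y : ℝ)

lemma aestronglyMeasurable_weightedIntegrand_mul {lam : Fin (n + 1) → ℂ} {w : Fin n → ℂ}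
    (hw : ∀ j k, |(lam k - w j).re| < g) {S : Set (Fin n → ℂ)} (hS : IsOpen S)
    (hf : DifferentiableOn ℂ f S) (hmem : ∀ t : Fin n → ℝ, (fun j => Complex.I * t j + w j) ∈ S) :
    AEStronglyMeasurable fun t : Fin n → ℝ =>
      weightedIntegrand g α β y lam (fun j => Complex.I * t j + w j) *
        f (fun j => Complex.I * t j + w j) := by
  refine Continuous.aestronglyMeasurable ?_
  rw [continuous_iff_continuousAt]
  intro t
  have hpath : Continuous fun t : Fin n → ℝ => (fun j => Complex.I * t j + w j) := by fun_prop
  refine ContinuousAt.mul ?_ ?_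
  · have h1 := (differentiableAt_weightedIntegrand α β y (g := g)
      (lam, fun j => Complex.I * t j + w j) (fun j k => by simpa using hw j k)).continuousAt
    exact ContinuousAt.comp
      (f := fun t : Fin n → ℝ => (lam, fun j => Complex.I * (t j : ℂ) + w j)) h1
      (continuous_const.prodMk hpath).continuousAt
  · exact ContinuousAt.comp (f := fun t : Fin n → ℝ => (fun j => Complex.I * (t j : ℂ) + w j))
      (hf.differentiableAt (hS.mem_nhds (hmem t))).continuousAt hpath.continuousAt

lemma exists_norm_barnesIntegrand_le
    (hf : HasSpectralDecay f {nu | ∀ j, (nu j).re = 0}) {ρ : ℝ} (hρ : ρ < g) :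
    ∃ C : ℝ, ∃ A : ℕ, 0 ≤ C ∧ ∀ (lam : Fin (n + 1) → ℂ), (∀ k, |(lam k).re| ≤ ρ) → ∀ t,
      ‖barnesIntegrand g lam y f t‖ ≤ C * polyGrowth (fun k => (lam k).im) ^ A *
          Real.exp (-(Real.pi / 4 * spread fun k => (lam k).im)) * cauchyDensity t := by
  obtain ⟨C₀, A₀, hC₀, h₀⟩ := hf
  obtain ⟨C, A, hC, h⟩ := exists_norm_weightedIntegrand_mul_le hρ (fun _ _ : Fin n => 0)
    (fun _ _ => g) y ρ C₀ A₀ hC₀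
  refine ⟨C, A, hC, fun lam hl t => ?_⟩
  have hρ0 := (abs_nonneg _).trans (hl 0)
  have := h lam (fun j => Complex.I * t j) (f fun j => Complex.I * t j) (by simpa using fun _ => hl)
    hl (by simpa using fun _ => hρ0) (h₀ _ (by simp))
  rw [barnesIntegrand_eq]
  simpa using this

lemma aestronglyMeasurable_barnesIntegrand (hg : 0 < g)
    (hd : DifferentiableOn ℂ f (polystrip g n)) {lam : Fin (n + 1) → ℂ}
    (hl : lam ∈ polystrip g (n + 1)) : AEStronglyMeasurable (barnesIntegrand g lam y f) := by
  have := aestronglyMeasurable_weightedIntegrand_mul (g := g) (fun _ _ => 0) (fun _ _ => g) y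
    (lam := lam) (w := 0) (fun j k => by simpa using hl k) (isOpen_polystrip g n) hd
    (by simpa using imaginary_mem_polystrip hg)
  refine this.congr (Filter.Eventually.of_forall fun t => ?_)
  simp [barnesIntegrand_eq]

lemma integrable_barnesIntegrand (hg : 0 < g) (hf : HasSpectralDecay f {nu | ∀ j, (nu j).re = 0})
    (hd : DifferentiableOn ℂ f (polystrip g n)) {lam : Fin (n + 1) → ℂ}
    (hl : lam ∈ polystrip g (n + 1)) : Integrable (barnesIntegrand g lam y f) := by
  obtain ⟨ρ, hρ, hle⟩ := exists_lt_forall_le hl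
  obtain ⟨C, A, hC, h⟩ := exists_norm_barnesIntegrand_le y hf hρ
  exact (integrable_cauchyDensity.const_mul _).mono'
    (aestronglyMeasurable_barnesIntegrand y hg hd hl) (Filter.Eventually.of_forall (h lam hle))

/-- This closes the induction: decay of `f` on the imaginary space alone yields the same kind of
decay in one more variable, even on strips of half-width `ρ < g`. -/
lemma hasSpectralDecay_barnesIntegral
    (hf : HasSpectralDecay f {nu | ∀ j, (nu j).re = 0}) {ρ : ℝ} (hρ : ρ < g) :
    HasSpectralDecay (fun lam => barnesIntegral g lam y f) {lam | ∀ k, |(lam k).re| ≤ ρ} := by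
  obtain ⟨C, A, hC, h⟩ := exists_norm_barnesIntegrand_le y hf hρ
  refine ⟨C * ∫ t : Fin n → ℝ, cauchyDensity t, A,
    mul_nonneg hC (integral_nonneg cauchyDensity_nonneg), fun lam hl => ?_⟩
  change ‖Complex.I ^ n * _‖ ≤ _
  rw [norm_mul, norm_pow, Complex.norm_I, one_pow, one_mul]
  refine (norm_integral_le_of_norm_le (integrable_cauchyDensity.const_mul _)
    (Filter.Eventually.of_forall (h lam hl))).trans_eq ?_
  rw [integral_const_mul]
  ring

lemma differentiableOn_barnesIntegral (hg : 0 < g)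
    (hf : HasSpectralDecay f {nu | ∀ j, (nu j).re = 0})
    (hd : DifferentiableOn ℂ f (polystrip g n)) :
    DifferentiableOn ℂ (fun lam => barnesIntegral g lam y f) (polystrip g (n + 1)) := by
  intro lam hl
  obtain ⟨ρ, hρ, hle⟩ := exists_lt_forall_le hl
  -- Half the margin: on the ball the real parts remain below `ρ + ε < g`, so one majorant serves
  -- the whole ball.
  set ε := (g - ρ) / 2 with hε
  have hε0 : 0 < ε := by linarith
  have hre : ∀ u ∈ Metric.ball lam ε, ∀ k, |(u k).re| ≤ ρ + ε := by
    intro u hu k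
    have h1 : ‖u k - lam k‖ < ε := (norm_le_pi_norm (u - lam) k).trans_lt (mem_ball_iff_norm.1 hu)
    have h2 := (Complex.abs_re_le_norm (u k - lam k)).trans h1.le
    rw [Complex.sub_re] at h2
    have := abs_le.1 h2
    have h3 := abs_le.1 (hle k)
    exact abs_le.2 ⟨by linarith, by linarith⟩
  have hmem : ∀ u ∈ Metric.ball lam ε, u ∈ polystrip g (n + 1) := fun u hu k =>
    (hre u hu k).trans_lt (by linarith)
  obtain ⟨C, A, hC, h⟩ := exists_norm_barnesIntegrand_le y hf (show ρ + ε < g by linarith)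
  set P := ∏ k, (1 + (|(lam k).im| + ε)) with hP
  have hPle : ∀ u ∈ Metric.ball lam ε, polyGrowth (fun k => (u k).im) ≤ P := by
    intro u hu
    refine Finset.prod_le_prod (fun _ _ => by positivity) fun k _ => ?_
    have h1 : ‖u k - lam k‖ < ε := (norm_le_pi_norm (u - lam) k).trans_lt (mem_ball_iff_norm.1 hu)
    have h2 := (Complex.abs_im_le_norm (u k - lam k)).trans h1.le
    rw [Complex.sub_im] at h2
    have := abs_sub_abs_le_abs_sub (u k).im (lam k).im
    linarith
  refine DifferentiableAt.differentiableWithinAt ?_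
  change DifferentiableAt ℂ (fun lam => Complex.I ^ n * _) lam
  refine DifferentiableAt.const_mul ?_ _
  refine differentiableAt_integral_of_dominated hε0 (bound := fun t => C * P ^ A * cauchyDensity t)
    (fun u hu => aestronglyMeasurable_barnesIntegrand y hg hd (hmem u hu)) (fun t => ?_)
    (fun u hu t => (h u (hre u hu) t).trans ?_) (integrable_cauchyDensity.const_mul _)
  · intro u hu
    refine DifferentiableAt.differentiableWithinAt ?_
    simp only [barnesIntegrand_eq]
    refine DifferentiableAt.mul_const ?_ _
    exact DifferentiableAt.comp u (f := fun u : Fin (n + 1) → ℂ =>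
      ((u, fun j => Complex.I * t j) : (Fin (n + 1) → ℂ) × (Fin n → ℂ)))
      (differentiableAt_weightedIntegrand _ _ y (g := g) (u, fun j => Complex.I * t j)
        (fun j k => by simpa using hmem u hu k)) (by fun_prop)
  · have hp := (polyGrowth_pos fun k => (u k).im).le
    have hexp : Real.exp (-(Real.pi / 4 * spread fun k => (u k).im)) ≤ 1 := by
      rw [Real.exp_le_one_iff]
      have := spread_nonneg fun k => (u k).im
      have := Real.pi_pos
      simp only [Left.neg_nonpos_iff]
      positivity
    have := cauchyDensity_nonneg t
    refine mul_le_mul_of_nonneg_right ?_ this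
    calc _ ≤ C * P ^ A * 1 := by
          gcongr
          exact hPle u hu
      _ = _ := mul_one _

end barnes

/-- Decay and holomorphy of `Φ` in the polystrip, where the defining integral still converges. -/
theorem Phi_decay_and_differentiableOn {g : ℝ} (hg : 0 < g) : ∀ (n : ℕ) (x : Fin n → ℝ),
    (∀ ρ < g, HasSpectralDecay (Phi g n x) {nu | ∀ j, |(nu j).re| ≤ ρ}) ∧
      DifferentiableOn ℂ (Phi g n x) (polystrip g n)
  | 0, x => by
    refine ⟨fun ρ _ => ⟨1, 0, zero_le_one, fun nu _ => ?_⟩, ?_⟩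
    · simp [Phi, spread]
    · exact (differentiable_const (1 : ℂ)).differentiableOn
  | n + 1, x => by
    obtain ⟨h1, h2⟩ := Phi_decay_and_differentiableOn hg n (Fin.init x)
    have h0 : HasSpectralDecay (Phi g n (Fin.init x)) {nu | ∀ j, (nu j).re = 0} := by
      obtain ⟨C, A, hC, h⟩ := h1 0 hg
      exact ⟨C, A, hC, fun nu hnu => h nu fun j => by simp [hnu j]⟩
    exact ⟨fun ρ hρ => hasSpectralDecay_barnesIntegral _ h0 hρ,
      differentiableOn_barnesIntegral _ hg h0 h2⟩

lemma Phi_decay_imaginary {g : ℝ} (hg : 0 < g) (n : ℕ) (x : Fin n → ℝ) :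
    HasSpectralDecay (Phi g n x) {nu | ∀ j, (nu j).re = 0} := by
  obtain ⟨C, A, hC, h⟩ := (Phi_decay_and_differentiableOn hg n x).1 0 hg
  exact ⟨C, A, hC, fun nu hnu => h nu fun j => by simp [hnu j]⟩

-- Continuation to the tube and its uniqueness

/-- Covariance of `Φ` under simultaneous imaginary translations. -/
theorem Phi_add_imaginary (g : ℝ) : ∀ (n : ℕ) (x : Fin n → ℝ) (nu : Fin n → ℂ) (s : ℝ),
    Phi g n x (fun j => nu j + s * Complex.I) =
      Complex.exp (s * Complex.I * ∑ j, (x j : ℂ)) * Phi g n x nu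
  | 0, x, nu, s => by simp [Phi]
  | n + 1, x, lam, s => by
    have ih := Phi_add_imaginary g n (Fin.init x)
    rw [Phi, Phi, barnesIntegral, barnesIntegral, mul_left_comm]
    congr 1
    rw [← integral_const_mul]
    -- Translating every `t j` by `s` moves `ν` together with `λ`, so weight and kernel are
    -- unchanged and only exponentials appear.
    rw [← integral_add_right_eq_self (μ := volume)
      (barnesIntegrand g (fun j => lam j + s * Complex.I) _ _) (fun _ : Fin n => s)]
    refine integral_congr_ae (Filter.Eventually.of_forall fun t => ?_)
    simp only [barnesIntegrand_eq]
    have hnu : (fun j => Complex.I * (((t + fun _ : Fin n => s) j : ℝ) : ℂ))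
        = fun j => Complex.I * t j + s * Complex.I := by
      ext j; simp; ring
    rw [hnu, ih, weightedIntegrand_add_const, Fin.sum_univ_castSucc, mul_add, Complex.exp_add]
    simp only [Fin.init]
    ring

lemma abs_convex_combination_lt {a b x y r : ℝ} (ha : 0 ≤ a) (hb : 0 ≤ b) (hab : a + b = 1)
    (hx : |x| < r) (hy : |y| < r) : |a * x + b * y| < r := by
  have h : Convex ℝ (Metric.ball (0 : ℝ) r) := convex_ball 0 r
  have := h (by simpa using hx : x ∈ Metric.ball (0 : ℝ) r)
    (by simpa using hy : y ∈ Metric.ball (0 : ℝ) r) ha hb hab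
  simpa using this

lemma isOpen_spectralTube (g : ℝ) (n : ℕ) : IsOpen (spectralTube g n) := by
  simp only [spectralTube, Set.ofPred_forall]
  exact isOpen_iInter_of_finite fun i => isOpen_iInter_of_finite fun j =>
    isOpen_lt (by fun_prop) continuous_const

lemma exists_center_of_mem_spectralTube {g : ℝ} {n : ℕ} {lam : Fin n → ℂ}
    (h : lam ∈ spectralTube g n) : ∃ c : ℝ, ∀ k, |(lam k).re - c| < g := by
  rcases isEmpty_or_nonempty (Fin n) with he | he
  · exact ⟨0, fun k => he.elim k⟩
  · obtain ⟨i, hi⟩ := Finite.exists_max fun k => (lam k).re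
    obtain ⟨j, hj⟩ := Finite.exists_min fun k => (lam k).re
    refine ⟨((lam i).re + (lam j).re) / 2, fun k => ?_⟩
    have h1 := abs_lt.1 (h i j)
    have h2 := hi k
    have h3 := hj k
    rw [Complex.sub_re] at h1
    exact abs_lt.2 ⟨by linarith, by linarith⟩

/-- As a function of a complex centre the expression is holomorphic on a convex strip and invariant
under imaginary translations by `Phi_add_imaginary`, hence constant. Recentring is thus independent
of the centre. -/
lemma exp_mul_Phi_sub_eq {g : ℝ} (hg : 0 < g) {n : ℕ} (x : Fin n → ℝ) (lam : Fin n → ℂ)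
    {c₁ c₂ : ℝ} (h₁ : ∀ k, |(lam k).re - c₁| < g) (h₂ : ∀ k, |(lam k).re - c₂| < g) :
    Complex.exp (c₁ * ∑ j, (x j : ℂ)) * Phi g n x (fun k => lam k - c₁) =
      Complex.exp (c₂ * ∑ j, (x j : ℂ)) * Phi g n x (fun k => lam k - c₂) := by
  have hU : IsOpen {z : ℂ | ∀ k, |(lam k - z).re| < g} := by
    simp only [Set.ofPred_forall]
    exact isOpen_iInter_of_finite fun j => isOpen_lt (by fun_prop) continuous_const
  have hc : Convex ℝ {z : ℂ | ∀ k, |(lam k - z).re| < g} := by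
    intro u hu v hv a b ha hb hab k
    have := abs_convex_combination_lt ha hb hab (hu k) (hv k)
    convert this using 2
    simp only [Complex.sub_re, Complex.add_re, Complex.smul_re, smul_eq_mul]
    linear_combination -(lam k).re * hab
  refine eq_of_imaginary_invariant (h := fun z => Complex.exp (z * ∑ j, (x j : ℂ)) *
    Phi g n x (fun k => lam k - z)) hU hc ?_ ?_ (by simpa using h₁) (by simpa using h₂)
  · intro z hz
    refine DifferentiableAt.differentiableWithinAt ?_
    refine DifferentiableAt.fun_mul (by fun_prop) ?_
    have hP := ((Phi_decay_and_differentiableOn hg n x).2).differentiableAt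
      ((isOpen_polystrip g n).mem_nhds (x := fun k => lam k - z) hz)
    exact DifferentiableAt.comp z (f := fun z : ℂ => fun k => lam k - z) hP (by fun_prop)
  · intro z _ s
    have h := Phi_add_imaginary g n x (fun k => lam k - (z + s * Complex.I)) s
    have e : (fun k => lam k - (z + s * Complex.I) + s * Complex.I) = fun k => lam k - z := by
      ext k; ring
    rw [e] at h
    rw [h, add_mul, Complex.exp_add]
    ring

open Classical in
/-- The analytic continuation of `Φ` to the tube, by recentring. -/
noncomputable def phiContinuation (g : ℝ) (n : ℕ) (x : Fin n → ℝ) (lam : Fin n → ℂ) : ℂ :=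
  if h : ∃ c : ℝ, ∀ k, |(lam k).re - c| < g then
    Complex.exp (h.choose * ∑ j, (x j : ℂ)) * Phi g n x (fun k => lam k - h.choose) else 0

lemma phiContinuation_eq {g : ℝ} (hg : 0 < g) {n : ℕ} (x : Fin n → ℝ) {lam : Fin n → ℂ} {c : ℝ}
    (h : ∀ k, |(lam k).re - c| < g) :
    phiContinuation g n x lam =
      Complex.exp (c * ∑ j, (x j : ℂ)) * Phi g n x (fun k => lam k - c) := by
  have hex : ∃ c : ℝ, ∀ k, |(lam k).re - c| < g := ⟨c, h⟩
  rw [phiContinuation, dif_pos hex]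
  exact exp_mul_Phi_sub_eq hg x lam hex.choose_spec h

lemma isPhiContinuation_phiContinuation {g : ℝ} (hg : 0 < g) (n : ℕ) (x : Fin n → ℝ) :
    IsPhiContinuation g n x (phiContinuation g n x) where
  holomorphic := by
    intro lam hl
    obtain ⟨c, hc⟩ := exists_center_of_mem_spectralTube hl
    refine DifferentiableAt.differentiableWithinAt ?_
    have hnear : ∀ᶠ u : Fin n → ℂ in nhds lam, ∀ k, |(u k).re - c| < g := by
      refine Filter.eventually_all.2 fun k => ?_
      exact (isOpen_lt (f := fun u : Fin n → ℂ => |(u k).re - c|) (by fun_prop)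
        continuous_const).mem_nhds (hc k)
    have heq : phiContinuation g n x =ᶠ[nhds lam] fun u =>
        Complex.exp (c * ∑ j, (x j : ℂ)) * Phi g n x (fun k => u k - c) := by
      filter_upwards [hnear] with u hu using phiContinuation_eq hg x hu
    refine DifferentiableAt.congr_of_eventuallyEq ?_ heq
    refine DifferentiableAt.const_mul ?_ _
    have hP := ((Phi_decay_and_differentiableOn hg n x).2).differentiableAt
      ((isOpen_polystrip g n).mem_nhds (x := fun k => lam k - c) fun k => by simpa using hc k)
    exact DifferentiableAt.comp lam (f := fun u : Fin n → ℂ => fun k => u k - (c : ℂ)) hP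
      (by fun_prop)
  eq_Phi := fun lam hl => by
    rw [phiContinuation_eq hg x (c := 0) fun k => by simpa [hl k] using hg]
    simp

/-- The imaginary space is a uniqueness set for holomorphic functions on the tube. -/
lemma eqOn_spectralTube_of_eq_on_imaginary {g : ℝ} (hg : 0 < g) {n : ℕ} {F G : (Fin n → ℂ) → ℂ}
    (hF : DifferentiableOn ℂ F (spectralTube g n)) (hG : DifferentiableOn ℂ G (spectralTube g n))
    (h : ∀ lam : Fin n → ℂ, (∀ j, (lam j).re = 0) → F lam = G lam) :
    Set.EqOn F G (spectralTube g n) := by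
  intro lam hl
  -- A complex line through `lam` at `z = 1` whose points are imaginary for imaginary `z`. The
  -- difference of the functions has zeros accumulating at `z = 0`, and the identity theorem in one
  -- variable applies.
  let L : ℂ → Fin n → ℂ := fun z j => z * (lam j).re + Complex.I * (lam j).im
  have hLre : ∀ z i j, (L z i - L z j).re = z.re * (lam i - lam j).re := by
    intro z i j
    simp [L]
    ring
  let U : Set ℂ := L ⁻¹' spectralTube g n
  have hLc : Continuous L := by fun_prop
  have hU : IsOpen U := (isOpen_spectralTube g n).preimage hLc
  have hUc : Convex ℝ U := by
    intro u hu v hv a b ha hb hab i j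
    have := abs_convex_combination_lt ha hb hab (hu i j) (hv i j)
    rw [hLre, hLre] at this
    rw [hLre]
    convert this using 2
    simp
    ring
  have h0 : (0 : ℂ) ∈ U := fun i j => by
    rw [hLre]; simpa using hg
  have h1 : (1 : ℂ) ∈ U := fun i j => by
    rw [hLre]; simpa using hl i j
  have hd : DifferentiableOn ℂ (fun z => F (L z) - G (L z)) U := by
    have hLd : DifferentiableOn ℂ L U := by
      have : Differentiable ℂ L := by fun_prop
      exact this.differentiableOn
    exact (hF.comp hLd fun z hz => hz).sub (hG.comp hLd fun z hz => hz)
  have hfreq : ∃ᶠ z in nhdsWithin (0 : ℂ) {0}ᶜ, F (L z) - G (L z) = 0 := by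
    have hτ : Filter.Tendsto (fun N : ℕ => ((1 / ((N : ℝ) + 1) : ℝ) : ℂ) * Complex.I) Filter.atTop
        (nhdsWithin 0 {0}ᶜ) := by
      refine tendsto_nhdsWithin_iff.2 ⟨?_, Filter.Eventually.of_forall fun N => ?_⟩
      · have := (Complex.continuous_ofReal.tendsto 0).comp
          (tendsto_one_div_add_atTop_nhds_zero_nat (𝕜 := ℝ))
        simpa using this.mul_const Complex.I
      · have : (1 / ((N : ℝ) + 1)) ≠ 0 := by positivity
        exact mul_ne_zero (Complex.ofReal_ne_zero.2 this) Complex.I_ne_zero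
    refine hτ.frequently (Filter.Frequently.of_forall fun N => ?_)
    rw [h, sub_self]
    intro j
    simp [L]
  have := (hd.analyticOnNhd hU).eqOn_zero_of_preconnected_of_frequently_eq_zero
    hUc.isPreconnected h0 hfreq h1
  have hL1 : L 1 = lam := by
    ext j
    simp only [L, one_mul]
    rw [mul_comm, Complex.re_add_im]
  simp only [hL1, Pi.zero_apply] at this
  exact sub_eq_zero.1 this

/-- By uniqueness on the tube, an arbitrary continuation inherits the integral formula and the decay
of the recentred one. -/
lemma IsPhiContinuation.eq_exp_mul_Phi {g : ℝ} (hg : 0 < g) {n : ℕ} {x : Fin n → ℝ}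
    {F : (Fin n → ℂ) → ℂ} (hF : IsPhiContinuation g n x F) {lam : Fin n → ℂ} {c : ℝ}
    (h : ∀ k, |(lam k).re - c| < g) :
    F lam = Complex.exp (c * ∑ j, (x j : ℂ)) * Phi g n x (fun k => lam k - c) := by
  have hC := isPhiContinuation_phiContinuation hg n x
  rw [← phiContinuation_eq hg x h]
  refine eqOn_spectralTube_of_eq_on_imaginary hg hF.holomorphic hC.holomorphic
    (fun u hu => (hF.eq_Phi u hu).trans (hC.eq_Phi u hu).symm) fun i j => ?_
  have h1 := abs_lt.1 (h i)
  have h2 := abs_lt.1 (h j)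
  rw [Complex.sub_re]
  exact abs_lt.2 ⟨by linarith, by linarith⟩

lemma IsPhiContinuation.hasSpectralDecay {g : ℝ} (hg : 0 < g) {n : ℕ} {x : Fin n → ℝ}
    {F : (Fin n → ℂ) → ℂ} (hF : IsPhiContinuation g n x F) {ρ : ℝ} (hρ : ρ < g) (c : ℝ) :
    HasSpectralDecay F {nu | ∀ k, |(nu k).re - c| ≤ ρ} := by
  obtain ⟨C, A, hC, h⟩ := (Phi_decay_and_differentiableOn hg n x).1 ρ hρ
  refine ⟨‖Complex.exp (c * ∑ j, (x j : ℂ))‖ * C, A, by positivity, fun nu hnu => ?_⟩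
  rw [hF.eq_exp_mul_Phi hg fun k => (hnu k).trans_lt hρ, norm_mul]
  have := h (fun k => nu k - c) fun k => by simpa using hnu k
  simp only [Complex.sub_im, Complex.ofReal_im, sub_zero] at this
  refine (mul_le_mul_of_nonneg_left this (norm_nonneg _)).trans_eq ?_
  ring

-- Moving contours

section contour

variable {n : ℕ} {g : ℝ} {f : (Fin n → ℂ) → ℂ} (α β : Fin n → Fin n → ℝ) (y : ℝ)
  {lam : Fin (n + 1) → ℂ} {B : Set (Fin n → ℝ)}

lemma isOpen_re_preimage (hB : IsOpen B) : IsOpen {w : Fin n → ℂ | (fun j => (w j).re) ∈ B} :=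
  hB.preimage (f := fun w : Fin n → ℂ => fun j => (w j).re) (by fun_prop)

/-- Gives one majorant for all base points near `w`, as needed for convergence and for holomorphy in
the position of the contour. The imaginary part of `u` only translates `t`, which costs a constant
by `cauchyDensity_add_le`. -/
lemma exists_local_domination (hB : IsOpen B)
    (hlam : ∀ a ∈ B, ∀ j k, |(lam k).re - a j| < g)
    (hdecay : ∀ a ∈ B, ∃ ε > 0, HasSpectralDecay f {nu | ∀ j, |(nu j).re - a j| ≤ ε})
    {w : Fin n → ℂ} (hw : (fun j => (w j).re) ∈ B) :
    ∃ ε > 0, ∃ C : ℝ, (∀ u ∈ Metric.ball w ε, (fun j => (u j).re) ∈ B) ∧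
      ∀ u ∈ Metric.ball w ε, ∀ t : Fin n → ℝ,
        ‖weightedIntegrand g α β y lam (fun j => Complex.I * t j + u j) *
          f (fun j => Complex.I * t j + u j)‖ ≤ C * cauchyDensity t := by
  obtain ⟨ρ, hρ, hle⟩ := exists_lt_forall_le (ι := Fin n × Fin (n + 1))
    (a := fun p => |(lam p.2).re - (w p.1).re|) (b := g) fun p => hlam _ hw p.1 p.2
  obtain ⟨ε₀, hε₀, C₀, A₀, hC₀, hf⟩ := hdecay _ hw
  obtain ⟨ε₁, hε₁, hball⟩ := Metric.isOpen_iff.1 (isOpen_re_preimage hB) w hw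
  set ε := min (min ε₀ ε₁) ((g - ρ) / 2) with hε
  have hεpos : 0 < ε := lt_min (lt_min hε₀ hε₁) (by linarith)
  have hε0 : ε ≤ ε₀ := (min_le_left _ _).trans (min_le_left _ _)
  have hε1 : ε ≤ ε₁ := (min_le_left _ _).trans (min_le_right _ _)
  have hε2 : ε ≤ (g - ρ) / 2 := min_le_right _ _
  obtain ⟨C, A, hC, h⟩ := exists_norm_weightedIntegrand_mul_le (show ρ + ε < g by linarith) α β y
    (∑ k, |(lam k).re| + ∑ j, |(w j).re| + ε) C₀ A₀ hC₀
  refine ⟨ε, hεpos, C * polyGrowth (fun k => (lam k).im) ^ A *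
    Real.exp (-(Real.pi / 4 * spread fun k => (lam k).im)) * (2 * (1 + (‖w‖ + ε) ^ 2)) ^ n,
    fun u hu => hball (Metric.ball_subset_ball hε1 hu), fun u hu t => ?_⟩
  have hnorm : ∀ j, ‖u j - w j‖ < ε := fun j =>
    (norm_le_pi_norm (u - w) j).trans_lt (mem_ball_iff_norm.1 hu)
  have hre : ∀ j, |(u j).re - (w j).re| ≤ ε := fun j => by
    rw [← Complex.sub_re]; exact (Complex.abs_re_le_norm _).trans (hnorm j).le
  have him : ∀ j, |(u j).im| ≤ ‖w‖ + ε := fun j => by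
    have h1 : ‖u‖ < ‖w‖ + ε := by
      have := norm_sub_norm_le u w
      have h2 := mem_ball_iff_norm.1 hu
      linarith
    exact (Complex.abs_im_le_norm _).trans ((norm_le_pi_norm u j).trans h1.le)
  have hreal : ∀ j, (Complex.I * (t j : ℂ) + u j).re = (u j).re := fun j => by simp
  have himag : ∀ j, (Complex.I * (t j : ℂ) + u j).im = t j + (u j).im := fun j => by simp
  have hsl : ∀ k, |(lam k).re| ≤ ∑ k, |(lam k).re| := fun k =>
    Finset.single_le_sum (f := fun k => |(lam k).re|) (fun _ _ => abs_nonneg _) (Finset.mem_univ k)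
  have hsw : ∀ j, |(w j).re| ≤ ∑ j, |(w j).re| := fun j =>
    Finset.single_le_sum (f := fun k => |(w k).re|) (fun _ _ => abs_nonneg _) (Finset.mem_univ j)
  have hnl : 0 ≤ ∑ k, |(lam k).re| := Finset.sum_nonneg fun _ _ => abs_nonneg _
  have hnw : 0 ≤ ∑ k, |(w k).re| := Finset.sum_nonneg fun _ _ => abs_nonneg _
  have key := h lam (fun j => Complex.I * t j + u j) (f fun j => Complex.I * t j + u j)
    (fun j k => by
      rw [Complex.sub_re, hreal]
      have h1 := abs_le.1 (hle (j, k))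
      have h2 := abs_le.1 (hre j)
      exact abs_le.2 ⟨by linarith, by linarith⟩)
    (fun k => by linarith [hsl k])
    (fun j => by
      rw [hreal]
      have := abs_sub_abs_le_abs_sub (u j).re (w j).re
      linarith [hre j, hsw j])
    (hf _ fun j => by rw [hreal]; exact (hre j).trans hε0)
  refine key.trans ?_
  have hcd := cauchyDensity_add_le (‖w‖ + ε) t (fun j => (u j).im) him
  have : cauchyDensity (fun j => (Complex.I * (t j : ℂ) + u j).im) ≤
      (2 * (1 + (‖w‖ + ε) ^ 2)) ^ n * cauchyDensity t := by
    simp only [himag]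
    exact hcd
  have hp := (polyGrowth_pos fun k => (lam k).im).le
  rw [mul_assoc _ _ (cauchyDensity t)]
  gcongr

/-- Absolute convergence on every vertical contour in the domain of holomorphy. -/
lemma integrable_on_contour (hB : IsOpen B)
    (hlam : ∀ a ∈ B, ∀ j k, |(lam k).re - a j| < g)
    (hf : DifferentiableOn ℂ f {w | (fun j => (w j).re) ∈ B})
    (hdecay : ∀ a ∈ B, ∃ ε > 0, HasSpectralDecay f {nu | ∀ j, |(nu j).re - a j| ≤ ε})
    {w : Fin n → ℂ} (hw : (fun j => (w j).re) ∈ B) :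
    Integrable fun t : Fin n → ℝ =>
      weightedIntegrand g α β y lam (fun j => Complex.I * t j + w j) *
          f (fun j => Complex.I * t j + w j) := by
  obtain ⟨ε, hε, C, _, h⟩ := exists_local_domination α β y hB hlam hdecay hw
  exact (integrable_cauchyDensity.const_mul C).mono'
    (aestronglyMeasurable_weightedIntegrand_mul α β y (fun j k => by simpa using hlam _ hw j k)
      (isOpen_re_preimage hB) hf fun t => by simpa using hw)
    (Filter.Eventually.of_forall (h w (Metric.mem_ball_self hε)))

/-- Independence of the integral from the contour. -/
lemma integral_contour_eq (hB : IsOpen B) (hBc : Convex ℝ B)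
    (hlam : ∀ a ∈ B, ∀ j k, |(lam k).re - a j| < g)
    (hf : DifferentiableOn ℂ f {w | (fun j => (w j).re) ∈ B})
    (hdecay : ∀ a ∈ B, ∃ ε > 0, HasSpectralDecay f {nu | ∀ j, |(nu j).re - a j| ≤ ε})
    {a b : Fin n → ℝ} (ha : a ∈ B) (hb : b ∈ B) :
    ∫ t : Fin n → ℝ, weightedIntegrand g α β y lam (fun j => Complex.I * t j + a j) *
          f (fun j => Complex.I * t j + a j) =
      ∫ t : Fin n → ℝ, weightedIntegrand g α β y lam (fun j => Complex.I * t j + b j) *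
          f (fun j => Complex.I * t j + b j) := by
  let D : (Fin n → ℂ) → (Fin n → ℝ) → ℂ := fun w t =>
    weightedIntegrand g α β y lam (fun j => Complex.I * t j + w j) *
          f (fun j => Complex.I * t j + w j)
  -- A complex affine path from `a` to `b`. An imaginary change of `z` is a translation of `t`, so
  -- the integral over the contour through `L z` is holomorphic and invariant, hence constant; no
  -- boundary terms at infinity arise.
  let L : ℂ → Fin n → ℂ := fun z j => a j + z * ((b j - a j : ℝ) : ℂ)
  let U : Set ℂ := {z | (fun j => (L z j).re) ∈ B}
  have hLre : ∀ z, (fun j => (L z j).re) = a + z.re • (b - a) := by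
    intro z
    ext j
    simp [L]
  have hLc : Continuous L := by fun_prop
  have hU : IsOpen U := (isOpen_re_preimage hB).preimage hLc
  have hUc : Convex ℝ U := by
    intro u hu v hv p q hp hq hpq
    change _ ∈ B at hu hv
    change _ ∈ B
    rw [hLre] at hu hv ⊢
    convert hBc hu hv hp hq hpq using 1
    ext j
    simp
    linear_combination -(a j) * hpq
  have hdiffD : ∀ w, (fun j => (w j).re) ∈ B → DifferentiableAt ℂ (fun w => ∫ t, D w t) w := by
    intro w hw
    obtain ⟨ε, hε, C, hball, h⟩ := exists_local_domination α β y hB hlam hdecay hw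
    refine differentiableAt_integral_of_dominated hε (bound := fun t => C * cauchyDensity t)
      (fun u hu => aestronglyMeasurable_weightedIntegrand_mul α β y
        (fun j k => by simpa using hlam _ (hball u hu) j k)
        (isOpen_re_preimage hB) hf fun t => by simpa using hball u hu) (fun t u hu => ?_) h
      (integrable_cauchyDensity.const_mul C)
    refine DifferentiableAt.differentiableWithinAt (DifferentiableAt.fun_mul ?_ ?_)
    · exact DifferentiableAt.comp u (f := fun u : Fin n → ℂ =>
        ((lam, fun j => Complex.I * t j + u j) : (Fin (n + 1) → ℂ) × (Fin n → ℂ)))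
        (differentiableAt_weightedIntegrand α β y (g := g) (lam, fun j => Complex.I * t j + u j)
          (fun j k => by simpa using hlam _ (hball u hu) j k)) (by fun_prop)
    · exact DifferentiableAt.comp u (f := fun u : Fin n → ℂ => fun j => Complex.I * t j + u j)
        (hf.differentiableAt ((isOpen_re_preimage hB).mem_nhds (by simpa using hball u hu)))
        (by fun_prop)
  have h := eq_of_imaginary_invariant (h := fun z => ∫ t, D (L z) t) hU hUc
    (fun z hz => (DifferentiableAt.comp z (f := L) (hdiffD (L z) hz)
      (by fun_prop)).differentiableWithinAt)
    (fun z _ s => by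
      rw [← integral_add_right_eq_self (μ := volume) (D (L z)) (fun j => s * (b j - a j))]
      refine integral_congr_ae (Filter.Eventually.of_forall fun t => ?_)
      have e : (fun j => Complex.I * t j + L (z + s * Complex.I) j)
          = fun j => Complex.I * (((t + fun j => s * (b j - a j)) j : ℝ) : ℂ) + L z j := by
        ext j
        simp [L]
        ring
      simp only [D, e]) (z₁ := 0) (z₂ := 1)
    (by change _ ∈ B; rw [hLre]; simpa using ha) (by change _ ∈ B; rw [hLre]; simpa using hb)
  have h0 : L 0 = fun j => (a j : ℂ) := by ext j; simp [L]
  have h1 : L 1 = fun j => (b j : ℂ) := by ext j; simp [L]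
  simpa only [h0, h1] using h

end contour

-- Absorbing difference coefficients and shifts into Gamma factors

lemma prod_prod_erase_split {n : ℕ} (J : Finset (Fin n)) (X : Fin n → Fin n → ℂ) :
    ∏ a, ∏ b ∈ Finset.univ.erase a, X a b =
      (∏ a ∈ J, ∏ b ∈ J.erase a, X a b) * (∏ a ∈ Jᶜ, ∏ b ∈ Jᶜ.erase a, X a b) *
        ∏ i ∈ J, ∏ j ∈ Jᶜ, (X i j * X j i) := by
  have h1 : ∀ (K : Finset (Fin n)), ∀ a ∈ K, ∏ b ∈ Finset.univ.erase a, X a b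
      = (∏ b ∈ K.erase a, X a b) * ∏ b ∈ Kᶜ, X a b := by
    intro K a ha
    rw [← Finset.prod_union]
    · refine Finset.prod_congr ?_ fun _ _ => rfl
      ext b
      by_cases hb : b ∈ K
      · simp [hb]
      · simp only [Finset.mem_erase, Finset.mem_univ, and_true, Finset.mem_union, hb, and_false,
          Finset.mem_compl, not_false_iff, or_true, iff_true]
        rintro rfl; exact hb ha
    · rw [Finset.disjoint_left]
      intro b hb hb'
      exact (Finset.mem_compl.1 hb') (Finset.mem_of_mem_erase hb)
  rw [← Finset.prod_mul_prod_compl J, Finset.prod_congr rfl (h1 J), Finset.prod_congr rfl (h1 Jᶜ),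
    Finset.prod_mul_distrib, Finset.prod_mul_distrib, compl_compl,
    Finset.prod_comm (s := Jᶜ) (t := J)]
  simp only [Finset.prod_mul_distrib]
  ring

/-- Only pairs separated by `J` meet a coefficient, and for those the two orders must be taken
together. -/
lemma prod_prod_erase_mul_eq {n : ℕ} (J : Finset (Fin n)) {X X' Y : Fin n → Fin n → ℂ}
    (h : ∀ a b, (a ∈ J ↔ b ∈ J) → X a b = X' a b)
    (h' : ∀ i j, i ∈ J → j ∉ J → X i j * X j i * Y i j = X' i j * X' j i) :
    (∏ a, ∏ b ∈ Finset.univ.erase a, X a b) * ∏ i ∈ J, ∏ j ∈ Jᶜ, Y i j =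
      ∏ a, ∏ b ∈ Finset.univ.erase a, X' a b := by
  rw [prod_prod_erase_split J X, prod_prod_erase_split J X', mul_assoc, ← Finset.prod_mul_distrib]
  congr 1
  · congr 1
    · refine Finset.prod_congr rfl fun a ha => Finset.prod_congr rfl fun b hb => h a b ?_
      simp [ha, Finset.mem_of_mem_erase hb]
    · refine Finset.prod_congr rfl fun a ha => Finset.prod_congr rfl fun b hb => h a b ?_
      simp [Finset.mem_compl.1 ha, Finset.mem_compl.1 (Finset.mem_of_mem_erase hb)]
  · refine Finset.prod_congr rfl fun i hi => ?_
    rw [← Finset.prod_mul_distrib]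
    exact Finset.prod_congr rfl fun j hj => h' i j hi (Finset.mem_compl.1 hj)

/-- Shifts of the Gamma arguments turning `μ` into `μ` times a Macdonald coefficient. -/
noncomputable def shiftAlpha {n : ℕ} (J : Finset (Fin n)) (a b : Fin n) : ℝ :=
  if a ∈ J ∧ b ∉ J then 1 else 0

/-- Shifts of the Gamma arguments turning `μ` into `μ` times a Macdonald coefficient. -/
noncomputable def shiftBeta (g : ℝ) {n : ℕ} (J : Finset (Fin n)) (a b : Fin n) : ℝ :=
  if a ∉ J ∧ b ∈ J then g - 1 else g

/-- The sign `(-1) ^ (|J| |Jᶜ|)`. -/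
noncomputable def crossSign {n : ℕ} (J : Finset (Fin n)) : ℂ := ∏ _i ∈ J, ∏ _j ∈ Jᶜ, (-1)

lemma crossSign_mul_self {n : ℕ} (J : Finset (Fin n)) : crossSign J * crossSign J = 1 := by
  rw [crossSign, ← Finset.prod_mul_distrib]
  refine Finset.prod_eq_one fun i _ => ?_
  rw [← Finset.prod_mul_distrib]
  exact Finset.prod_eq_one fun j _ => by norm_num

/-- The recurrence for `1 / Γ(z)` cancels the pole of the coefficient, and the one for `1 / Γ(-z + g
- 1)` absorbs its numerator. At `z = 0` both sides are zero. -/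
lemma inv_Gamma_pair_mul (z g : ℂ) :
    ((Complex.Gamma z)⁻¹ * (Complex.Gamma (z + g))⁻¹) *
      ((Complex.Gamma (-z))⁻¹ * (Complex.Gamma (-z + g))⁻¹) *
        -((2 * z + 2 - 2 * g) / (2 * z)) =
      ((Complex.Gamma (z + 1))⁻¹ * (Complex.Gamma (z + g))⁻¹) *
        ((Complex.Gamma (-z))⁻¹ * (Complex.Gamma (-z + (g - 1)))⁻¹) := by
  rcases eq_or_ne z 0 with rfl | hz
  · simp [Complex.Gamma_zero]
  · have h1 := Complex.one_div_Gamma_eq_self_mul_one_div_Gamma_add_one z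
    have h2 := Complex.one_div_Gamma_eq_self_mul_one_div_Gamma_add_one (-z + (g - 1))
    rw [show -z + (g - 1) + 1 = -z + g by ring] at h2
    rw [h1, h2]
    field_simp
    ring

lemma inv_Gamma_pair_mul' (z g : ℂ) :
    ((Complex.Gamma z)⁻¹ * (Complex.Gamma (z + g))⁻¹) *
      ((Complex.Gamma (-z))⁻¹ * (Complex.Gamma (-z + g))⁻¹) *
        -((2 * z + 2 * g - 2) / (2 * z)) =
      ((Complex.Gamma z)⁻¹ * (Complex.Gamma (z - 1 + g))⁻¹) *
        ((Complex.Gamma (-z + 1))⁻¹ * (Complex.Gamma (-z + g))⁻¹) := by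
  rcases eq_or_ne z 0 with rfl | hz
  · simp [Complex.Gamma_zero]
  · have h1 := Complex.one_div_Gamma_eq_self_mul_one_div_Gamma_add_one (-z)
    have h2 := Complex.one_div_Gamma_eq_self_mul_one_div_Gamma_add_one (z - 1 + g)
    rw [show z - 1 + g + 1 = z + g by ring] at h2
    rw [h1, h2]
    field_simp
    ring

/-- The coefficient alone is singular at coinciding `ν`, whereas the right-hand side is entire; this
form allows the contour to be moved. -/
lemma sklyaninWeight_mul_coeff (g : ℝ) {n : ℕ} (J : Finset (Fin n)) (nu : Fin n → ℂ) :
    sklyaninWeight g nu *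
        ∏ i ∈ J, ∏ j ∈ Jᶜ, (nu i - nu j + 2 - 2 * (g : ℂ)) / (nu i - nu j) =
      crossSign J * shiftedWeight (shiftAlpha J) (shiftBeta g J) nu := by
  rw [sklyaninWeight_eq]
  have h : shiftedWeight (fun _ _ => 0) (fun _ _ => g) nu *
      ∏ i ∈ J, ∏ j ∈ Jᶜ, -((nu i - nu j + 2 - 2 * (g : ℂ)) / (nu i - nu j)) =
        shiftedWeight (shiftAlpha J) (shiftBeta g J) nu := by
    refine prod_prod_erase_mul_eq J (fun a b hab => ?_) fun i j hi hj => ?_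
    · have h1 : ¬ (a ∈ J ∧ b ∉ J) := fun h => h.2 (hab.1 h.1)
      have h2 : ¬ (a ∉ J ∧ b ∈ J) := fun h => h.1 (hab.2 h.2)
      simp [shiftAlpha, shiftBeta, h1, h2]
    · have e := inv_Gamma_pair_mul ((nu i - nu j) / 2) g
      have s1 : -((nu i - nu j) / 2) = (nu j - nu i) / 2 := by ring
      have s2 : 2 * ((nu i - nu j) / 2) = nu i - nu j := by ring
      rw [s1, s2] at e
      simpa [shiftAlpha, shiftBeta, hi, hj] using e
  have hs : ∏ i ∈ J, ∏ j ∈ Jᶜ, -((nu i - nu j + 2 - 2 * (g : ℂ)) / (nu i - nu j))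
      = crossSign J * ∏ i ∈ J, ∏ j ∈ Jᶜ, (nu i - nu j + 2 - 2 * (g : ℂ)) / (nu i - nu j) := by
    simp only [crossSign, ← Finset.prod_mul_distrib, neg_one_mul]
  rw [← h, hs]
  linear_combination (-(shiftedWeight (fun _ _ => 0) (fun _ _ => g) nu) *
    ∏ i ∈ J, ∏ j ∈ Jᶜ, (nu i - nu j + 2 - 2 * (g : ℂ)) / (nu i - nu j)) * crossSign_mul_self J

/-- Evaluates the entire weight after the substitution on `J`: `μ` reappears, with the coefficients
required by `rational_kernel_identity` in the inner variables. -/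
lemma shiftedWeight_shift (g : ℝ) {n : ℕ} (J : Finset (Fin n)) (nu : Fin n → ℂ) :
    crossSign J * shiftedWeight (shiftAlpha J) (shiftBeta g J)
        (fun j => if j ∈ J then nu j - 2 else nu j) =
      sklyaninWeight g nu *
        ∏ i ∈ J, ∏ j ∈ Jᶜ, (nu i - nu j + (2 * (g : ℂ) - 2)) / (nu i - nu j) := by
  rw [sklyaninWeight_eq]
  have h : shiftedWeight (fun _ _ => 0) (fun _ _ => g) nu *
      ∏ i ∈ J, ∏ j ∈ Jᶜ, -((nu i - nu j + (2 * (g : ℂ) - 2)) / (nu i - nu j)) =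
        shiftedWeight (shiftAlpha J) (shiftBeta g J)
          (fun j => if j ∈ J then nu j - 2 else nu j) := by
    refine prod_prod_erase_mul_eq J (fun a b hab => ?_) fun i j hi hj => ?_
    · have h1 : ¬ (a ∈ J ∧ b ∉ J) := fun h => h.2 (hab.1 h.1)
      have h2 : ¬ (a ∉ J ∧ b ∈ J) := fun h => h.1 (hab.2 h.2)
      by_cases ha : a ∈ J
      · simp [shiftAlpha, shiftBeta, ha, hab.1 ha]
      · have hb : b ∉ J := fun hb => ha (hab.2 hb)
        simp [shiftAlpha, shiftBeta, ha, hb]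
    · have e := inv_Gamma_pair_mul' ((nu i - nu j) / 2) g
      have s1 : -((nu i - nu j) / 2) = (nu j - nu i) / 2 := by ring
      have s2 : 2 * ((nu i - nu j) / 2) = nu i - nu j := by ring
      have s3 : (nu i - 2 - nu j) / 2 + 1 = (nu i - nu j) / 2 := by ring
      have s4 : (nu i - 2 - nu j) / 2 = (nu i - nu j) / 2 - 1 := by ring
      have s5 : (nu j - (nu i - 2)) / 2 + ((g : ℂ) - 1) = (nu j - nu i) / 2 + g := by ring
      have s6 : (nu j - (nu i - 2)) / 2 = (nu j - nu i) / 2 + 1 := by ring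
      rw [s1, s2] at e
      simp only [shiftAlpha, shiftBeta, hi, hj, if_true, if_false, not_true, not_false_iff,
        and_true, and_false, Complex.ofReal_one, Complex.ofReal_zero, add_zero,
        Complex.ofReal_sub, s3, s5]
      rw [s4, s6, ← add_sub_assoc]
      exact e
  have hs : ∏ i ∈ J, ∏ j ∈ Jᶜ, -((nu i - nu j + (2 * (g : ℂ) - 2)) / (nu i - nu j))
      = crossSign J * ∏ i ∈ J, ∏ j ∈ Jᶜ, (nu i - nu j + (2 * (g : ℂ) - 2)) / (nu i - nu j) := by
    simp only [crossSign, ← Finset.prod_mul_distrib, neg_one_mul]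
  rw [← h, hs]
  linear_combination ((shiftedWeight (fun _ _ => 0) (fun _ _ => g) nu) *
    ∏ i ∈ J, ∏ j ∈ Jᶜ, (nu i - nu j + (2 * (g : ℂ) - 2)) / (nu i - nu j)) * crossSign_mul_self J

/-- The ratio by which a pair of Gamma factors in the kernel changes under a shift by `2`. -/
noncomputable def kernelRatio (g : ℝ) (u : ℂ) : ℂ := (u + g) / (-u + g - 2)

/-- A pair depends only on `u = λ - ν`, so raising `λ` and lowering `ν` by `2` produce the same
ratio. This lets a single rational identity match both sides. -/
lemma Gamma_pair_shift (g : ℝ) {u : ℂ} (h1 : u + g ≠ 0) (h2 : -u + g - 2 ≠ 0) :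
    Complex.Gamma ((-(u + 2) + g) / 2) * Complex.Gamma ((u + 2 + g) / 2) =
      Complex.Gamma ((-u + g) / 2) * Complex.Gamma ((u + g) / 2) * kernelRatio g u := by
  have e1 : Complex.Gamma ((u + 2 + g) / 2) = (u + g) / 2 * Complex.Gamma ((u + g) / 2) := by
    rw [← Complex.Gamma_add_one _ (div_ne_zero h1 two_ne_zero)]
    congr 1; ring
  have e2 : Complex.Gamma ((-u + g) / 2)
      = (-u + g - 2) / 2 * Complex.Gamma ((-(u + 2) + g) / 2) := by
    rw [show (-(u + 2) + (g : ℂ)) / 2 = (-u + g - 2) / 2 by ring,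
      ← Complex.Gamma_add_one _ (div_ne_zero h2 two_ne_zero)]
    congr 1; ring
  rw [e1, e2, kernelRatio]
  field_simp

lemma gammaKernel_eq (g : ℝ) {n : ℕ} (lam : Fin (n + 1) → ℂ) (nu : Fin n → ℂ) :
    gammaKernel g lam nu = ∏ j, ∏ k, (Complex.Gamma ((-(lam k - nu j) + g) / 2) *
      Complex.Gamma ((lam k - nu j + g) / 2)) := by
  simp only [gammaKernel, neg_sub]

lemma gammaKernel_shift_left (g : ℝ) {n : ℕ} (lam : Fin (n + 1) → ℂ) (nu : Fin n → ℂ)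
    (h1 : ∀ k j, lam k - nu j + g ≠ 0) (h2 : ∀ k j, -(lam k - nu j) + g - 2 ≠ 0)
    (s : Finset (Fin (n + 1))) :
    gammaKernel g (fun k => if k ∈ s then lam k + 2 else lam k) nu =
      gammaKernel g lam nu * ∏ k ∈ s, ∏ j, kernelRatio g (lam k - nu j) := by
  have hs : ∏ k ∈ s, ∏ j, kernelRatio g (lam k - nu j)
      = ∏ k, ∏ j, if k ∈ s then kernelRatio g (lam k - nu j) else 1 := by
    rw [← Finset.prod_subset (Finset.subset_univ s)]
    · exact Finset.prod_congr rfl fun k hk => by simp [hk]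
    · exact fun k _ hk => by simp [hk]
  rw [gammaKernel_eq, gammaKernel_eq, hs, Finset.prod_comm,
    Finset.prod_comm (f := fun j k => Complex.Gamma ((-(lam k - nu j) + g) / 2) * _),
    ← Finset.prod_mul_distrib]
  refine Finset.prod_congr rfl fun k _ => ?_
  rw [← Finset.prod_mul_distrib]
  refine Finset.prod_congr rfl fun j _ => ?_
  split_ifs
  · rw [← Gamma_pair_shift g (h1 k j) (h2 k j), add_sub_right_comm]
  · rw [mul_one]

lemma gammaKernel_shift_right (g : ℝ) {n : ℕ} (lam : Fin (n + 1) → ℂ) (nu : Fin n → ℂ)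
    (h1 : ∀ k j, lam k - nu j + g ≠ 0) (h2 : ∀ k j, -(lam k - nu j) + g - 2 ≠ 0)
    (J : Finset (Fin n)) :
    gammaKernel g lam (fun j => if j ∈ J then nu j - 2 else nu j) =
      gammaKernel g lam nu * ∏ j ∈ J, ∏ k, kernelRatio g (lam k - nu j) := by
  have hJ : ∏ j ∈ J, ∏ k, kernelRatio g (lam k - nu j)
      = ∏ j, ∏ k, if j ∈ J then kernelRatio g (lam k - nu j) else 1 := by
    rw [← Finset.prod_subset (Finset.subset_univ J)]
    · exact Finset.prod_congr rfl fun j hj => by simp [hj]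
    · exact fun j _ hj => by simp [hj]
  rw [gammaKernel_eq, gammaKernel_eq, hJ, ← Finset.prod_mul_distrib]
  refine Finset.prod_congr rfl fun j _ => ?_
  rw [← Finset.prod_mul_distrib]
  refine Finset.prod_congr rfl fun k _ => ?_
  split_ifs
  · rw [← Gamma_pair_shift g (h1 k j) (h2 k j), show lam k - (nu j - 2) = lam k - nu j + 2 by ring]
  · rw [mul_one]

lemma sum_ite_add {n : ℕ} (s : Finset (Fin n)) (v : Fin n → ℂ) (c : ℂ) :
    ∑ k, (if k ∈ s then v k + c else v k) = ∑ k, v k + s.card * c := by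
  have : ∀ k, (if k ∈ s then v k + c else v k) = v k + if k ∈ s then c else 0 := fun k => by
    split_ifs <;> simp
  simp only [this, Finset.sum_add_distrib, Finset.sum_ite_mem, Finset.univ_inter,
    Finset.sum_const, nsmul_eq_mul]

lemma weightedIntegrand_shift_left (g : ℝ) {n : ℕ} (y : ℝ) (lam : Fin (n + 1) → ℂ)
    (nu : Fin n → ℂ) (h1 : ∀ k j, lam k - nu j + g ≠ 0) (h2 : ∀ k j, -(lam k - nu j) + g - 2 ≠ 0)
    (s : Finset (Fin (n + 1))) :
    weightedIntegrand g (fun _ _ => 0) (fun _ _ => g) y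
        (fun k => if k ∈ s then lam k + 2 else lam k) nu =
      Complex.exp (s.card * 2 * y) *
        weightedIntegrand g (fun _ _ => 0) (fun _ _ => g) y lam nu *
        ∏ k ∈ s, ∏ j, kernelRatio g (lam k - nu j) := by
  have e : (∑ k, lam k + (s.card : ℂ) * 2 - ∑ j, nu j) * (y : ℂ)
      = s.card * 2 * y + (∑ k, lam k - ∑ j, nu j) * y := by ring
  rw [weightedIntegrand, weightedIntegrand, gammaKernel_shift_left g lam nu h1 h2, sum_ite_add, e,
    Complex.exp_add]
  ring

lemma weightedIntegrand_shift_right (g : ℝ) {n : ℕ} (y : ℝ) (lam : Fin (n + 1) → ℂ)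
    (nu : Fin n → ℂ) (h1 : ∀ k j, lam k - nu j + g ≠ 0) (h2 : ∀ k j, -(lam k - nu j) + g - 2 ≠ 0)
    (J : Finset (Fin n)) :
    crossSign J * weightedIntegrand g (shiftAlpha J) (shiftBeta g J) y lam
        (fun j => if j ∈ J then nu j - 2 else nu j) =
      Complex.exp (J.card * 2 * y) *
        weightedIntegrand g (fun _ _ => 0) (fun _ _ => g) y lam nu *
        ((∏ i ∈ J, ∏ j ∈ Jᶜ, (nu i - nu j + (2 * (g : ℂ) - 2)) / (nu i - nu j)) *
          ∏ j ∈ J, ∏ k, kernelRatio g (lam k - nu j)) := by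
  have e : (∑ k, lam k - (∑ j, nu j + (J.card : ℂ) * (-2))) * (y : ℂ)
      = J.card * 2 * y + (∑ k, lam k - ∑ j, nu j) * y := by ring
  have hW := shiftedWeight_shift g J nu
  rw [sklyaninWeight_eq] at hW
  have hsum := sum_ite_add J nu (-2)
  simp only [← sub_eq_add_neg] at hsum
  rw [weightedIntegrand, weightedIntegrand, gammaKernel_shift_right g lam nu h1 h2, hsum, e,
    Complex.exp_add]
  linear_combination (gammaKernel g lam nu * (∏ j ∈ J, ∏ k, kernelRatio g (lam k - nu j)) *
    (Complex.exp (J.card * 2 * y) * Complex.exp ((∑ k, lam k - ∑ j, nu j) * y))) * hW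

/-- The kernel function identity in the form in which it is used under the integral. -/
lemma kernelRatio_identity (g : ℝ) {n : ℕ} (lam : Fin (n + 1) → ℂ) (nu : Fin n → ℂ)
    (hl : Function.Injective lam) (hn : Function.Injective nu)
    (h1 : ∀ k j, lam k - nu j + g ≠ 0) (h2 : ∀ k j, -(lam k - nu j) + g - 2 ≠ 0) (r : ℕ) :
    (-1) ^ ((r + 1) * n) * ∑ s ∈ (Finset.univ : Finset (Fin (n + 1))).powersetCard (r + 1),
        (∏ i ∈ s, ∏ j ∈ sᶜ, (lam i - lam j + 2 - 2 * (g : ℂ)) / (lam i - lam j)) *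
          ∏ k ∈ s, ∏ j, kernelRatio g (lam k - nu j) =
      (-1) ^ (r * (n - 1)) * ∑ J ∈ (Finset.univ : Finset (Fin n)).powersetCard r,
        (∏ i ∈ J, ∏ j ∈ Jᶜ, (nu i - nu j + (2 * (g : ℂ) - 2)) / (nu i - nu j)) *
          ∏ j ∈ J, ∏ k, kernelRatio g (lam k - nu j) +
      (-1) ^ ((r + 1) * (n - 1)) * ∑ J ∈ (Finset.univ : Finset (Fin n)).powersetCard (r + 1),
        (∏ i ∈ J, ∏ j ∈ Jᶜ, (nu i - nu j + (2 * (g : ℂ) - 2)) / (nu i - nu j)) *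
          ∏ j ∈ J, ∏ k, kernelRatio g (lam k - nu j) := by
  -- The rational identity is used with `v = ν - g` and `a = 2g - 2`; each fraction is then minus a
  -- kernel ratio, and these signs account for the prefactors of the operators.
  have hq : ∀ k j, (lam k - (nu j - g)) / (lam k - (nu j - g) - (2 * (g : ℂ) - 2))
      = -1 * kernelRatio g (lam k - nu j) := by
    intro k j
    rw [kernelRatio, neg_one_mul, ← div_neg]
    congr 1 <;> ring
  have key := rational_kernel_identity lam (fun j => nu j - g) (2 * (g : ℂ) - 2) r hl
    (fun i j h => hn (by simpa using h))
    (fun k j => by rw [sub_sub_eq_add_sub, add_sub_right_comm]; exact h1 k j)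
    (fun k j h => h2 k j (by linear_combination -h))
  simp only [hq, Finset.prod_mul_distrib, Finset.prod_const, Finset.card_univ, Fintype.card_fin,
    sub_sub_sub_cancel_right] at key
  have hL : ∀ s ∈ (Finset.univ : Finset (Fin (n + 1))).powersetCard (r + 1),
      (∏ i ∈ s, ∏ j ∈ sᶜ, (lam i - lam j - (2 * (g : ℂ) - 2)) / (lam i - lam j)) *
          (((-1) ^ n) ^ s.card * ∏ k ∈ s, ∏ j, kernelRatio g (lam k - nu j)) =
      (-1) ^ ((r + 1) * n) *
        ((∏ i ∈ s, ∏ j ∈ sᶜ, (lam i - lam j + 2 - 2 * (g : ℂ)) / (lam i - lam j)) *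
          ∏ k ∈ s, ∏ j, kernelRatio g (lam k - nu j)) := by
    intro s hs
    rw [(Finset.mem_powersetCard.1 hs).2, ← pow_mul, mul_comm n]
    simp only [← sub_add, sub_add_eq_add_sub]
    ring
  have hR : ∀ m, ∀ J ∈ (Finset.univ : Finset (Fin n)).powersetCard m,
      (∏ i ∈ J, ∏ j ∈ Jᶜ, (nu i - nu j + (2 * (g : ℂ) - 2)) / (nu i - nu j)) *
          (((-1) ^ (n + 1)) ^ J.card * ∏ j ∈ J, ∏ k, kernelRatio g (lam k - nu j)) =
      (-1) ^ (m * (n - 1)) *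
        ((∏ i ∈ J, ∏ j ∈ Jᶜ, (nu i - nu j + (2 * (g : ℂ) - 2)) / (nu i - nu j)) *
          ∏ j ∈ J, ∏ k, kernelRatio g (lam k - nu j)) := by
    intro m J hJ
    have hc := (Finset.mem_powersetCard.1 hJ).2
    have hs : ((-1 : ℂ) ^ (n + 1)) ^ J.card = (-1) ^ (m * (n - 1)) := by
      rw [hc]
      -- For `n = 0` the truncated `n - 1` and `n + 1` differ in parity, but then only `m = 0`
      -- occurs.
      rcases n with _ | n
      · have : m = 0 := by rw [← hc]; simpa using J.card_le_univ
        simp [this]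
      · rw [← pow_mul, Nat.add_sub_cancel, show (n + 1 + 1) * m = m * n + 2 * m by ring, pow_add,
          pow_mul (-1 : ℂ) 2]
        simp
    rw [hs]
    ring
  rw [Finset.sum_congr rfl hL, Finset.sum_congr rfl (hR (r + 1)), Finset.sum_congr rfl (hR r),
    ← Finset.mul_sum, ← Finset.mul_sum, ← Finset.mul_sum] at key
  rw [key, add_comm]

lemma sklyaninWeight_eq_zero_of_not_injective (g : ℝ) {n : ℕ} {nu : Fin n → ℂ}
    (h : ¬ Function.Injective nu) : sklyaninWeight g nu = 0 := by
  obtain ⟨i, j, hij, hne⟩ : ∃ i j, nu i = nu j ∧ i ≠ j := by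
    simpa [Function.Injective] using h
  refine Finset.prod_eq_zero (Finset.mem_univ i) (Finset.prod_eq_zero (i := j) ?_ ?_)
  · simpa using hne.symm
  · simp [hij, Complex.Gamma_zero]

-- Both sides on a common contour

/-- The numbers `Re λ_k` and `Re λ_k + 2` together span less than `(2g - 2) + 2 = 2g`, so their
midpoint is within `g` of all of them. -/
lemma exists_contour {g : ℝ} {n : ℕ} {lam : Fin (n + 1) → ℂ}
    (h : ∀ i j, |(lam i - lam j).re| < 2 * g - 2) :
    ∃ c : ℝ, (∀ k, |(lam k).re - c| < g) ∧ ∀ k, |(lam k).re + 2 - c| < g := by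
  obtain ⟨i, hi⟩ := Finite.exists_max fun k => (lam k).re
  obtain ⟨j, hj⟩ := Finite.exists_min fun k => (lam k).re
  have h1 := abs_lt.1 (h i j)
  rw [Complex.sub_re] at h1
  refine ⟨((lam i).re + (lam j).re) / 2 + 1, fun k => ?_, fun k => ?_⟩ <;>
    exact abs_lt.2 ⟨by linarith [hi k, hj k], by linarith [hi k, hj k]⟩

section identity

variable {g : ℝ} {n : ℕ} {x : Fin (n + 1) → ℝ} {lam : Fin (n + 1) → ℂ} {c : ℝ}
  {G : (Fin n → ℂ) → ℂ}

/-- The common part of the integrands, on the contour `Re ν = c`. -/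
noncomputable def baseIntegrand (g : ℝ) {n : ℕ} (y : ℝ) (lam : Fin (n + 1) → ℂ) (c : ℝ)
    (G : (Fin n → ℂ) → ℂ) (t : Fin n → ℝ) : ℂ :=
  weightedIntegrand g (fun _ _ => 0) (fun _ _ => g) y lam (fun j => Complex.I * t j + c) *
    G (fun j => Complex.I * t j + c)

/-- With centre `c`, every partially shifted `lam` lies in the recentred polystrip, whatever `s` is.
One contour thus serves all terms of the operator, and the shift survives only in the kernel ratios.
-/
lemma continuation_shift_eq_integral (hg : 0 < g) {F : (Fin (n + 1) → ℂ) → ℂ}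
    (hF : IsPhiContinuation g (n + 1) x F) (hG : IsPhiContinuation g n (Fin.init x) G)
    (hc1 : ∀ k, |(lam k).re - c| < g) (hc2 : ∀ k, |(lam k).re + 2 - c| < g)
    (s : Finset (Fin (n + 1))) :
    (Integrable fun t => baseIntegrand g (x (Fin.last n)) lam c G t *
        ∏ k ∈ s, ∏ j, kernelRatio g (lam k - (Complex.I * t j + c))) ∧
      F (fun k => if k ∈ s then lam k + 2 else lam k) =
        Complex.I ^ n * (Complex.exp (s.card * 2 * x (Fin.last n)) *
          ∫ t, baseIntegrand g (x (Fin.last n)) lam c G t *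
            ∏ k ∈ s, ∏ j, kernelRatio g (lam k - (Complex.I * t j + c))) := by
  set y := x (Fin.last n) with hy
  set lams : Fin (n + 1) → ℂ := fun k => if k ∈ s then lam k + 2 else lam k with hlams
  have hs : ∀ k, |(lams k).re - c| < g := by
    intro k
    simp only [hlams]
    split_ifs
    · simpa using hc2 k
    · exact hc1 k
  have hmem : (fun k => lams k - c) ∈ polystrip g (n + 1) := fun k => by simpa using hs k
  have hint := integrable_barnesIntegrand y hg (Phi_decay_imaginary hg n (Fin.init x))
    (Phi_decay_and_differentiableOn hg n (Fin.init x)).2 hmem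
  have h1 : ∀ (t : Fin n → ℝ) k j, lam k - (Complex.I * t j + c) + g ≠ 0 := by
    intro t k j h
    have := congrArg Complex.re h
    have hb := abs_lt.1 (hc1 k)
    simp at this
    linarith
  have h2 : ∀ (t : Fin n → ℝ) k j, -(lam k - (Complex.I * t j + c)) + g - 2 ≠ 0 := by
    intro t k j h
    have := congrArg Complex.re h
    have hb := abs_lt.1 (hc2 k)
    simp at this
    linarith
  have hpt : ∀ t, Complex.exp (c * ∑ j, (x j : ℂ)) *
      barnesIntegrand g (fun k => lams k - c) y (Phi g n (Fin.init x)) t =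
      Complex.exp (s.card * 2 * y) * (baseIntegrand g y lam c G t *
        ∏ k ∈ s, ∏ j, kernelRatio g (lam k - (Complex.I * t j + c))) := by
    intro t
    have hGt := hG.eq_exp_mul_Phi hg (lam := fun j => Complex.I * t j + c) (c := c)
      fun k => by simpa using hg
    simp only [add_sub_cancel_right] at hGt
    have hW := weightedIntegrand_add_const g (fun _ _ => 0) (fun _ _ => g) y
      (fun k => lams k - c) (fun j => Complex.I * t j) c
    simp only [sub_add_cancel] at hW
    rw [hlams, weightedIntegrand_shift_left g y lam _ (h1 t) (h2 t)] at hW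
    have hsum : ∑ j, (x j : ℂ) = ∑ j, (Fin.init x j : ℂ) + y := Fin.sum_univ_castSucc _
    rw [barnesIntegrand_eq, baseIntegrand, hGt, hsum, mul_add, Complex.exp_add]
    linear_combination (-(Complex.exp (c * ∑ j, (Fin.init x j : ℂ)) *
      Phi g n (Fin.init x) fun j => Complex.I * t j)) * hW
  have hexp : Complex.exp (s.card * 2 * y) ≠ 0 := Complex.exp_ne_zero _
  constructor
  · refine ((hint.const_mul (Complex.exp (c * ∑ j, (x j : ℂ)))).const_mul
      (Complex.exp (s.card * 2 * y))⁻¹).congr (Filter.Eventually.of_forall fun t => ?_)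
    simp only [hpt]
    rw [inv_mul_cancel_left₀ hexp]
  · rw [hF.eq_exp_mul_Phi hg hs, Phi, barnesIntegral, mul_left_comm]
    congr 1
    rw [← integral_const_mul, ← integral_const_mul]
    exact integral_congr_ae (Filter.Eventually.of_forall hpt)

/-- The contour moves from `Re ν = 0` to `Re ν_j = c - 2` on `J` and `Re ν_j = c` off `J`, after
which the argument of `G` has real part `c` throughout. -/
lemma integral_term_eq (hg : 1 < g) (hG : IsPhiContinuation g n (Fin.init x) G) (y : ℝ)
    (hl : ∀ k, |(lam k).re| < g)
    (hc1 : ∀ k, |(lam k).re - c| < g) (hc2 : ∀ k, |(lam k).re + 2 - c| < g)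
    (J : Finset (Fin n)) :
    (Integrable fun t : Fin n → ℝ =>
      weightedIntegrand g (shiftAlpha J) (shiftBeta g J) y lam (fun j => Complex.I * t j) *
        G (fun j => if j ∈ J then Complex.I * t j + 2 else Complex.I * t j)) ∧
    (Integrable fun t : Fin n → ℝ => baseIntegrand g y lam c G t *
      ((∏ i ∈ J, ∏ j ∈ Jᶜ, (Complex.I * t i + c - (Complex.I * t j + c) + (2 * (g : ℂ) - 2)) /
          (Complex.I * t i + c - (Complex.I * t j + c))) *
        ∏ j ∈ J, ∏ k, kernelRatio g (lam k - (Complex.I * t j + c)))) ∧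
    crossSign J * ∫ t : Fin n → ℝ,
      weightedIntegrand g (shiftAlpha J) (shiftBeta g J) y lam (fun j => Complex.I * t j) *
        G (fun j => if j ∈ J then Complex.I * t j + 2 else Complex.I * t j) =
    Complex.exp (J.card * 2 * y) * ∫ t : Fin n → ℝ, baseIntegrand g y lam c G t *
      ((∏ i ∈ J, ∏ j ∈ Jᶜ, (Complex.I * t i + c - (Complex.I * t j + c) + (2 * (g : ℂ) - 2)) /
          (Complex.I * t i + c - (Complex.I * t j + c))) *
        ∏ j ∈ J, ∏ k, kernelRatio g (lam k - (Complex.I * t j + c))) := by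
  have hg0 : 0 < g := by linarith
  let e : Fin n → ℝ := fun j => if j ∈ J then 2 else 0
  let f : (Fin n → ℂ) → ℂ := fun w => G fun j => if j ∈ J then w j + 2 else w j
  have hsh : ∀ (w : Fin n → ℂ), (fun j => if j ∈ J then w j + 2 else w j)
      = fun j => w j + (e j : ℂ) := by
    intro w; ext j; simp only [e]; split_ifs <;> simp
  -- Real parts for which the kernel meets no pole and the shifted argument of `G` lies in the tube.
  -- Convexity keeps the whole deformation inside.
  let B : Set (Fin n → ℝ) := {a | (∀ j k, |(lam k).re - a j| < g) ∧
    ∀ i j, |(a i + e i) - (a j + e j)| < 2 * g}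
  have hB : IsOpen B := by
    refine IsOpen.inter (s := {a : Fin n → ℝ | ∀ j k, |(lam k).re - a j| < g})
      (t := {a : Fin n → ℝ | ∀ i j, |(a i + e i) - (a j + e j)| < 2 * g}) ?_ ?_
    · simp only [Set.ofPred_forall]
      exact isOpen_iInter_of_finite fun i => isOpen_iInter_of_finite fun j =>
        isOpen_lt (by fun_prop) continuous_const
    · simp only [Set.ofPred_forall]
      exact isOpen_iInter_of_finite fun i => isOpen_iInter_of_finite fun j =>
        isOpen_lt (by fun_prop) continuous_const
  have hBc : Convex ℝ B := by
    intro u hu v hv p q hp hq hpq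
    refine ⟨fun j k => ?_, fun i j => ?_⟩
    · have := abs_convex_combination_lt hp hq hpq (hu.1 j k) (hv.1 j k)
      convert this using 2
      simp only [Pi.add_apply, Pi.smul_apply, smul_eq_mul]
      linear_combination -(lam k).re * hpq
    · have := abs_convex_combination_lt hp hq hpq (hu.2 i j) (hv.2 i j)
      convert this using 2
      simp only [Pi.add_apply, Pi.smul_apply, smul_eq_mul]
      linear_combination (e j - e i) * hpq
  have hf : DifferentiableOn ℂ f {w | (fun j => (w j).re) ∈ B} := by
    intro w hw
    refine DifferentiableAt.differentiableWithinAt ?_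
    simp only [f, hsh]
    refine DifferentiableAt.comp w (f := fun w : Fin n → ℂ => fun j => w j + (e j : ℂ)) ?_
      (by fun_prop)
    refine hG.holomorphic.differentiableAt ((isOpen_spectralTube g n).mem_nhds fun i j => ?_)
    simpa using hw.2 i j
  have hdecay : ∀ a ∈ B, ∃ ε > 0, HasSpectralDecay f {nu | ∀ j, |(nu j).re - a j| ≤ ε} := by
    intro a ha
    obtain ⟨m, hm⟩ := exists_center_of_mem_spectralTube (g := g)
      (lam := fun j => ((a j + e j : ℝ) : ℂ)) fun i j => by simpa using ha.2 i j
    obtain ⟨ρ, hρ, hle⟩ := exists_lt_forall_le hm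
    obtain ⟨C, A, hC, h⟩ := hG.hasSpectralDecay hg0
      (show ρ + (g - ρ) / 2 < g by linarith) m
    refine ⟨(g - ρ) / 2, by linarith, C, A, hC, fun nu hnu => ?_⟩
    have := h (fun j => nu j + (e j : ℂ)) fun j => by
      have h1 := abs_le.1 (hle j)
      have h2 := abs_le.1 (hnu j)
      simp only [Complex.ofReal_re] at h1
      simp only [Complex.add_re, Complex.ofReal_re]
      exact abs_le.2 ⟨by linarith, by linarith⟩
    simp only [f, hsh]
    simpa using this
  -- The original contour is admissible because `|Re λ_k| < g` and because a shift by `2` stays in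
  -- the tube when `g > 1`.
  have ha0 : (fun _ : Fin n => (0 : ℝ)) ∈ B := by
    refine ⟨fun _ k => by simpa using hl k, fun i j => ?_⟩
    simp only [e]
    split_ifs <;> rw [abs_lt] <;> constructor <;> linarith
  let b : Fin n → ℝ := fun j => if j ∈ J then c - 2 else c
  have hb : b ∈ B := by
    refine ⟨fun j k => ?_, fun i j => ?_⟩
    · simp only [b]
      split_ifs
      · rw [show (lam k).re - (c - 2) = (lam k).re + 2 - c by ring]; exact hc2 k
      · exact hc1 k
    · have : ∀ i, b i + e i = c := fun i => by simp only [b, e]; split_ifs <;> ring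
      rw [this, this]
      simpa using hg0
  have h1 : ∀ (t : Fin n → ℝ) k j, lam k - (Complex.I * t j + c) + g ≠ 0 := by
    intro t k j h
    have := congrArg Complex.re h
    have hb := abs_lt.1 (hc1 k)
    simp at this
    linarith
  have h2 : ∀ (t : Fin n → ℝ) k j, -(lam k - (Complex.I * t j + c)) + g - 2 ≠ 0 := by
    intro t k j h
    have := congrArg Complex.re h
    have hb := abs_lt.1 (hc2 k)
    simp at this
    linarith
  have hpt : ∀ t : Fin n → ℝ, crossSign J * (weightedIntegrand g (shiftAlpha J) (shiftBeta g J) y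
      lam (fun j => Complex.I * t j + b j) * f (fun j => Complex.I * t j + b j)) =
      Complex.exp (J.card * 2 * y) * (baseIntegrand g y lam c G t *
      ((∏ i ∈ J, ∏ j ∈ Jᶜ, (Complex.I * t i + c - (Complex.I * t j + c) + (2 * (g : ℂ) - 2)) /
          (Complex.I * t i + c - (Complex.I * t j + c))) *
        ∏ j ∈ J, ∏ k, kernelRatio g (lam k - (Complex.I * t j + c)))) := by
    intro t
    have hW := weightedIntegrand_shift_right g y lam (fun j => Complex.I * t j + c) (h1 t) (h2 t) J
    have hnu : (fun j => if j ∈ J then Complex.I * (t j : ℂ) + c - 2 else Complex.I * t j + c)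
        = fun j => Complex.I * (t j : ℂ) + b j := by
      ext j; simp only [b]; split_ifs <;> push_cast <;> ring
    have hfe : f (fun j => Complex.I * t j + b j) = G (fun j => Complex.I * t j + c) := by
      simp only [f]
      congr 1
      ext j; simp only [b]; split_ifs <;> push_cast <;> ring
    rw [hnu] at hW
    rw [hfe, baseIntegrand, ← mul_assoc, hW]
    ring
  have hexp : Complex.exp (J.card * 2 * y) ≠ 0 := Complex.exp_ne_zero _
  have hi0 := integrable_on_contour (shiftAlpha J) (shiftBeta g J) y (w := fun _ => 0) hB
    (fun a ha => ha.1) hf hdecay (by simpa using ha0)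
  have hib := integrable_on_contour (shiftAlpha J) (shiftBeta g J) y (w := fun j => (b j : ℂ)) hB
    (fun a ha => ha.1) hf hdecay (by simpa using hb)
  refine ⟨by simpa [f] using hi0, ?_, ?_⟩
  · refine ((hib.const_mul (crossSign J)).const_mul
      (Complex.exp (J.card * 2 * y))⁻¹).congr (Filter.Eventually.of_forall fun t => ?_)
    simp only [hpt]
    rw [inv_mul_cancel_left₀ hexp]
  · have hshift := integral_contour_eq (shiftAlpha J) (shiftBeta g J) y hB hBc
      (fun a ha => ha.1) hf hdecay ha0 hb
    simp only [Complex.ofReal_zero, add_zero] at hshift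
    simp only [f] at hshift hpt
    rw [hshift, ← integral_const_mul, ← integral_const_mul]
    exact integral_congr_ae (Filter.Eventually.of_forall hpt)

lemma barnesIntegrand_dualHamiltonian (g : ℝ) {n : ℕ} (lam : Fin (n + 1) → ℂ) (y : ℝ)
    (G : (Fin n → ℂ) → ℂ) (r : ℕ) (t : Fin n → ℝ) :
    barnesIntegrand g lam y (dualHamiltonian g r G) t =
      (-1) ^ (r * (n - 1)) * ∑ J ∈ (Finset.univ : Finset (Fin n)).powersetCard r,
        crossSign J * (weightedIntegrand g (shiftAlpha J) (shiftBeta g J) y lam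
          (fun j => Complex.I * t j) *
            G (fun j => if j ∈ J then Complex.I * t j + 2 else Complex.I * t j)) := by
  rw [barnesIntegrand_eq, dualHamiltonian, mul_left_comm, Finset.mul_sum]
  congr 1
  refine Finset.sum_congr rfl fun J _ => ?_
  have := sklyaninWeight_mul_coeff g J (fun j => Complex.I * t j)
  rw [sklyaninWeight_eq] at this
  rw [weightedIntegrand, weightedIntegrand]
  linear_combination (gammaKernel g lam (fun j => Complex.I * t j) *
    Complex.exp ((∑ k, lam k - ∑ j, Complex.I * (t j : ℂ)) * y) *
    G (fun j => if j ∈ J then Complex.I * t j + 2 else Complex.I * t j)) * this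

/-- The integrals on the right-hand side, moved to the contour `Re ν = c`. -/
lemma barnesIntegral_dualHamiltonian (hg : 1 < g) (hG : IsPhiContinuation g n (Fin.init x) G)
    (y : ℝ) (hl : ∀ k, |(lam k).re| < g)
    (hc1 : ∀ k, |(lam k).re - c| < g) (hc2 : ∀ k, |(lam k).re + 2 - c| < g) (r : ℕ) :
    Integrable (barnesIntegrand g lam y (dualHamiltonian g r G)) ∧
    (Integrable fun t : Fin n → ℝ => baseIntegrand g y lam c G t * ((-1) ^ (r * (n - 1)) *
      ∑ J ∈ (Finset.univ : Finset (Fin n)).powersetCard r,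
      (∏ i ∈ J, ∏ j ∈ Jᶜ, (Complex.I * t i + c - (Complex.I * t j + c) + (2 * (g : ℂ) - 2)) /
          (Complex.I * t i + c - (Complex.I * t j + c))) *
        ∏ j ∈ J, ∏ k, kernelRatio g (lam k - (Complex.I * t j + c)))) ∧
    barnesIntegral g lam y (dualHamiltonian g r G) = Complex.I ^ n * (Complex.exp (r * 2 * y) *
      ∫ t : Fin n → ℝ, baseIntegrand g y lam c G t * ((-1) ^ (r * (n - 1)) *
      ∑ J ∈ (Finset.univ : Finset (Fin n)).powersetCard r,
      (∏ i ∈ J, ∏ j ∈ Jᶜ, (Complex.I * t i + c - (Complex.I * t j + c) + (2 * (g : ℂ) - 2)) /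
          (Complex.I * t i + c - (Complex.I * t j + c))) *
        ∏ j ∈ J, ∏ k, kernelRatio g (lam k - (Complex.I * t j + c)))) := by
  have hterm := integral_term_eq hg hG y hl hc1 hc2
  have hfun : barnesIntegrand g lam y (dualHamiltonian g r G) = fun t =>
      (-1) ^ (r * (n - 1)) * ∑ J ∈ (Finset.univ : Finset (Fin n)).powersetCard r,
        crossSign J * (weightedIntegrand g (shiftAlpha J) (shiftBeta g J) y lam
          (fun j => Complex.I * t j) *
            G (fun j => if j ∈ J then Complex.I * t j + 2 else Complex.I * t j)) :=
    funext (barnesIntegrand_dualHamiltonian g lam y G r)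
  have hmul : ∀ (b ε : ℂ) (R : Finset (Fin n) → ℂ),
      b * (ε * ∑ J ∈ (Finset.univ : Finset (Fin n)).powersetCard r, R J) =
        ∑ J ∈ (Finset.univ : Finset (Fin n)).powersetCard r, ε * (b * R J) := fun b ε R => by
    rw [mul_left_comm, Finset.mul_sum, Finset.mul_sum]
  simp only [hmul]
  refine ⟨?_, ?_, ?_⟩
  · rw [hfun]
    exact (integrable_finsetSum _ fun J _ => (hterm J).1.const_mul _).const_mul _
  · exact integrable_finsetSum _ fun J _ => (hterm J).2.1.const_mul _
  · rw [barnesIntegral, hfun, integral_const_mul,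
      integral_finsetSum _ fun J _ => (hterm J).1.const_mul _,
      integral_finsetSum _ fun J _ => (hterm J).2.1.const_mul _]
    congr 1
    rw [Finset.mul_sum, Finset.mul_sum]
    refine Finset.sum_congr rfl fun J hJ => ?_
    rw [integral_const_mul, integral_const_mul, (hterm J).2.2, (Finset.mem_powersetCard.1 hJ).2]
    ring

end identity

theorem proposition1 (g : ℝ) (hg : 1 < g) (n r : ℕ) (hr : 1 ≤ r) (hrn : r ≤ n + 1)
    (x : Fin (n + 1) → ℝ) :
    (∀ lam : Fin (n + 1) → ℂ, (∀ j, (lam j).re = 0) →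
      Integrable (barnesIntegrand g lam (x (Fin.last n)) (Phi g n (Fin.init x)))) ∧
    (∃ F, IsPhiContinuation g (n + 1) x F) ∧
    (∃ G, IsPhiContinuation g n (Fin.init x) G) ∧
    ∀ F G, IsPhiContinuation g (n + 1) x F → IsPhiContinuation g n (Fin.init x) G →
      ∀ lam : Fin (n + 1) → ℂ, Function.Injective lam →
        (∀ j, |(lam j).re| < g) →
        (∀ i j, |(lam i - lam j).re| < 2 * g - 2) →
        Integrable (barnesIntegrand g lam (x (Fin.last n)) (dualHamiltonian g (r - 1) G)) ∧
        Integrable (barnesIntegrand g lam (x (Fin.last n)) (dualHamiltonian g r G)) ∧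
        dualHamiltonian g r F lam =
          Complex.exp (2 * (x (Fin.last n) : ℂ)) *
              barnesIntegral g lam (x (Fin.last n)) (dualHamiltonian g (r - 1) G) +
            barnesIntegral g lam (x (Fin.last n)) (dualHamiltonian g r G) := by
  have hg0 : 0 < g := by linarith
  refine ⟨fun lam hlam => integrable_barnesIntegrand _ hg0
      (Phi_decay_imaginary hg0 n (Fin.init x)) (Phi_decay_and_differentiableOn hg0 n (Fin.init x)).2
      fun j => by simpa [hlam j] using hg0,
    ⟨_, isPhiContinuation_phiContinuation hg0 _ _⟩, ⟨_, isPhiContinuation_phiContinuation hg0 _ _⟩,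
    fun F G hF hG lam hinj hl hd => ?_⟩
  obtain ⟨r, rfl⟩ : ∃ m, r = m + 1 := ⟨r - 1, by omega⟩
  rw [Nat.add_sub_cancel]
  obtain ⟨c, hc1, hc2⟩ := exists_contour hd
  obtain ⟨i1, j1, e1⟩ := barnesIntegral_dualHamiltonian hg hG (x (Fin.last n)) hl hc1 hc2 r
  obtain ⟨i2, j2, e2⟩ := barnesIntegral_dualHamiltonian hg hG (x (Fin.last n)) hl hc1 hc2 (r + 1)
  have hF' := continuation_shift_eq_integral hg0 hF hG hc1 hc2
  refine ⟨i1, i2, ?_⟩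
  -- Moving `r` inner variables yields one factor `exp (2 x_n)` fewer than shifting `r + 1` outer
  -- ones; the prefactor in the statement compensates.
  have hexp : Complex.exp (2 * (x (Fin.last n) : ℂ)) * Complex.exp (r * 2 * x (Fin.last n))
      = Complex.exp ((r + 1 : ℕ) * 2 * x (Fin.last n)) := by
    rw [← Complex.exp_add]
    congr 1
    push_cast
    ring
  have hrhs : ∀ a b E : ℂ, Complex.exp (2 * (x (Fin.last n) : ℂ)) *
      (E * (Complex.exp (r * 2 * x (Fin.last n)) * a)) +
      E * (Complex.exp ((r + 1 : ℕ) * 2 * x (Fin.last n)) * b) =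
      E * (Complex.exp ((r + 1 : ℕ) * 2 * x (Fin.last n)) * (a + b)) := by
    intro a b E
    rw [← hexp]
    ring
  rw [e1, e2, hrhs, ← integral_add j1 j2]
  have hlhs : dualHamiltonian g (r + 1) F lam = Complex.I ^ n *
      (Complex.exp ((r + 1 : ℕ) * 2 * x (Fin.last n)) *
        ∫ t : Fin n → ℝ, (-1) ^ ((r + 1) * n) *
          ∑ s ∈ (Finset.univ : Finset (Fin (n + 1))).powersetCard (r + 1),
          (∏ i ∈ s, ∏ j ∈ sᶜ, (lam i - lam j + 2 - 2 * (g : ℂ)) / (lam i - lam j)) *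
          (baseIntegrand g (x (Fin.last n)) lam c G t *
            ∏ k ∈ s, ∏ j, kernelRatio g (lam k - (Complex.I * t j + c)))) := by
    rw [integral_const_mul, integral_finsetSum _ fun s _ => (hF' s).1.const_mul _, dualHamiltonian,
      Nat.add_sub_cancel, mul_left_comm _ ((-1 : ℂ) ^ _), mul_left_comm _ ((-1 : ℂ) ^ _),
      Finset.mul_sum (a := Complex.exp _), Finset.mul_sum (a := Complex.I ^ n)]
    congr 1
    refine Finset.sum_congr rfl fun s hs => ?_
    rw [(hF' s).2, integral_const_mul, (Finset.mem_powersetCard.1 hs).2]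
    ring
  rw [hlhs]
  congr 2
  refine integral_congr_ae (Filter.Eventually.of_forall fun t => ?_)
  have h1 : ∀ k j, lam k - (Complex.I * t j + c) + g ≠ 0 := by
    intro k j h
    have := congrArg Complex.re h
    have hb := abs_lt.1 (hc1 k)
    simp at this
    linarith
  have h2 : ∀ k j, -(lam k - (Complex.I * t j + c)) + g - 2 ≠ 0 := by
    intro k j h
    have := congrArg Complex.re h
    have hb := abs_lt.1 (hc2 k)
    simp at this
    linarith
  simp only [mul_left_comm _ (baseIntegrand g (x (Fin.last n)) lam c G t), ← Finset.mul_sum]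
  rw [← mul_add]
  -- The rational identity needs distinct `ν`; where two coincide, the Sklyanin weight makes both
  -- integrands vanish.
  by_cases hn : Function.Injective fun j => Complex.I * (t j : ℂ) + c
  · rw [kernelRatio_identity g lam _ hinj hn h1 h2 r]
  · have : baseIntegrand g (x (Fin.last n)) lam c G t = 0 := by
      rw [baseIntegrand, weightedIntegrand, ← sklyaninWeight_eq,
        sklyaninWeight_eq_zero_of_not_injective g hn]
      simp
    rw [this, zero_mul, zero_mul]
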